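/- **Setting.** A *Sumcheck instance* $(G,F,q,a)$ consists of a connected graph $G$ on $n\ge 1$ nodes with identifiers $0,\dots,n-1$, together with a spanning tree of $G$ rooted at node $0$ (every other node knows the identifier of its parent), a prime $q$, a polynomial $F\in\mathbb F_q[x_1,\dots,x_N]$ with $N\ge 1$ and of degree at most $d$ in each variable, and a value $a\in\mathbb F_q$. The numbers $n,N,d,q$ and a security parameter $t\ge 1$ are public. Initially a node knows, in addition, $a$, its own identifier, those of its neighbours and that of its parent; it can access $F$ only through an evaluation oracle. In a *distributed interactive proof* the nodes, using private coins, and an unbounded prover first exchange messages in alternating rounds, the last of which is the prover's: in a prover round the prover sends a message to every node, in a verifier round every node sends a message to the prover. Afterwards the nodes, without the prover, run a distributed verification algorithm in which each node finally accepts or rejects. $\mathcal C[R,B]$ denotes the randomized synchronous distributed algorithms with at most $R$ communication rounds and at most $B$ bits per edge, direction and round. The *view* of a node consists of its coins, all messages it exchanges with the prover, and all messages of neighbours and oracle answers it receives during the verification. A *simulator* is a distributed algorithm without a prover (but with the oracle for $F$) that outputs a view at each node. **Theorem (Distributed ZK Sumcheck).** There are a distributed interactive proof $\Pi$ and a simulator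 $S$, both depending only on the public parameters $n,N,d,t,q$, an honest (randomized) prover for each instance, and a function $\varepsilon$ that is negligible in $n$ (i.e. $n^k\varepsilon(n)\to 0$ for every $k$) such that the following holds for all $n,N,t\ge 1$, all $d$, all primes $q$ and all Sumcheck instances $(G,F,q,a)$ with these parameters. * **Completeness.** If $\sum_{x\in\{0,1\}^N}F(x)=a$, then with the honest prover all nodes accept with probability $1$. * **Soundness.** If $\sum_{x\in\{0,1\}^N}F(x)\ne a$, then for every prover the probability that all nodes accept is at most $\frac{Nd}{q}+\frac1t$. * **Statistical zero-knowledge.** If $\sum_{x\in\{0,1\}^N}F(x)=a$, then for every node $v$ the total variation distance between the output of $S$ at $v$ and the view of $v$ in the execution of $\Pi$ with the honest prover is at most $\varepsilon(n)$. * **Complexity.** $\Pi$ has $O(N)$ rounds of interaction. If $t$ is fixed and $d=O(n)$, each message between the prover and a node has $O(\log q)$ bits, and the verification algorithm and the simulator belong to $\mathcal C[O(1),O(N\log q)]$. The constants for the numbers of rounds are absolute; those for the message sizes depend only on $t$ and on the constant in $d=O(n)$. In every execution, with any prover, the nodes together make at most one oracle query to $F$ in the verification, and also at most one in every run of the simulator.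 -/

import Mathlib

namespace DistSumcheck

/-! ### Probability over finite uniform coins -/

/-- The probability of the event `E` when `ω` is uniform in the finite type `Ω`. -/
noncomputable def prob {Ω : Type} [Fintype Ω] (E : Set Ω) : ℝ :=
  (E.ncard : ℝ) / (Fintype.card Ω : ℝ)

/-- Total variation distance `sup_A |Pr[X ∈ A] - Pr[Y ∈ A]|` between the distributions of two
random variables on (different) finite uniform probability spaces. -/
noncomputable def tvDist {Ω Ω' α : Type} [Fintype Ω] [Fintype Ω'] (X : Ω → α) (Y : Ω' → α) : ℝ :=
  ⨆ A : Set α, |prob {ω | X ω ∈ A} - prob {ω | Y ω ∈ A}|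

/-! ### Sumcheck instances -/

/-- A message of exactly `ℓ` bits. -/
abbrev Msg (ℓ : ℕ) : Type := Fin ℓ → Bool

/-- A Sumcheck instance `(G, F, q, a)`: a connected graph whose `n` nodes are their identifiers
`0, …, n - 1`, a spanning tree of it rooted at the node `0` and given by parent pointers,
an `N`-variate polynomial over `𝔽_q` of individual degree at most `d`, and the claimed sum. -/
structure SumcheckInstance (n N d q : ℕ) [NeZero n] where
  graph : SimpleGraph (Fin n)
  connected : graph.Connected
  parent : Fin n → Option (Fin n)
  parent_eq_none_iff : ∀ v, parent v = none ↔ v = 0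
  parent_adj : ∀ v u, parent v = some u → graph.Adj v u
  reaches_root : ∀ v, Relation.ReflTransGen (fun x y => parent x = some y) v 0
  poly : MvPolynomial (Fin N) (ZMod q)
  degreeOf_le : ∀ i, poly.degreeOf i ≤ d
  target : ZMod q

/-- What a node knows at the start besides the public parameters: its identifier, the identifiers
of its neighbours, the identifier of its parent in the tree (if any) and the claimed sum `a`. -/
structure LocalInput (n q : ℕ) where
  id : Fin n
  nbrs : Set (Fin n)
  parent : Option (Fin n)
  target : ZMod q

namespace SumcheckInstance

variable {n N d q : ℕ} [NeZero n]

def localInput (I : SumcheckInstance n N d q) (v : Fin n) : LocalInput n q where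
  id := v
  nbrs := I.graph.neighborSet v
  parent := I.parent v
  target := I.target

/-- The evaluation oracle for the polynomial. -/
noncomputable def oracle (I : SumcheckInstance n N d q) (x : Fin N → ZMod q) : ZMod q :=
  MvPolynomial.eval x I.poly

/-- The claim `∑_{x ∈ {0,1}^N} F(x) = a`. -/
def Claim (I : SumcheckInstance n N d q) : Prop :=
  ∑ x : Fin N → Bool, I.oracle (fun i => if x i then 1 else 0) = I.target

end SumcheckInstance

/-! ### Synchronous distributed algorithms with an evaluation oracle -/

/-- What a node has received while a distributed algorithm runs: the answers to its oracle queries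
(one optional query per stage) and, for each past round, the messages of its neighbours
(`none` for a node that is not a neighbour). -/
structure LocalHist (n q B : ℕ) where
  answers : List (Option (ZMod q))
  inbox : List (Fin n → Option (Msg B))

/-- A randomized distributed algorithm on `n` nodes with private inputs in `In` and outputs in
`Out`, which runs in `rounds` synchronous rounds with messages of `bits` bits on every edge in each
direction. Before each round, and before the output, a node may query the oracle. All local
functions depend only on the input, the coins and the history of the node itself. -/
structure DistAlg (n N q : ℕ) (In Out : Type) where
  rounds : ℕ
  bits : ℕ
  Coin : Type
  [coinFintype : Fintype Coin]
  [coinNonempty : Nonempty Coin]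
  query : In → Coin → LocalHist n q bits → Option (Fin N → ZMod q)
  /-- the message to the given neighbour -/
  send : In → Coin → LocalHist n q bits → Fin n → Msg bits
  output : In → Coin → LocalHist n q bits → Out

attribute [instance] DistAlg.coinFintype DistAlg.coinNonempty

namespace DistAlg

variable {n N q : ℕ} {In Out : Type}

/-- The history of a node after its (optional) query at the current stage. -/
def ask (A : DistAlg n N q In Out) (O : (Fin N → ZMod q) → ZMod q) (x : In) (c : A.Coin)
    (h : LocalHist n q A.bits) : LocalHist n q A.bits :=
  { h with answers := h.answers ++ [(A.query x c h).map O] }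

open Classical in
/-- The histories of all nodes after `s` rounds on the graph `G`. -/
noncomputable def hist (A : DistAlg n N q In Out) (G : SimpleGraph (Fin n))
    (O : (Fin N → ZMod q) → ZMod q) (x : Fin n → In) (c : Fin n → A.Coin) :
    ℕ → Fin n → LocalHist n q A.bits
  | 0 => fun _ => ⟨[], []⟩
  | s + 1 => fun v =>
      let h : Fin n → LocalHist n q A.bits := fun u => A.ask O (x u) (c u) (hist A G O x c s u)
      { h v with
        inbox := (h v).inbox ++
          [fun u => if G.Adj u v then some (A.send (x u) (c u) (h u) v) else none] }

/-- The history of a node at the end, after its last optional query. -/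
noncomputable def finalHist (A : DistAlg n N q In Out) (G : SimpleGraph (Fin n))
    (O : (Fin N → ZMod q) → ZMod q) (x : Fin n → In) (c : Fin n → A.Coin) (v : Fin n) :
    LocalHist n q A.bits :=
  A.ask O (x v) (c v) (A.hist G O x c A.rounds v)

noncomputable def out (A : DistAlg n N q In Out) (G : SimpleGraph (Fin n))
    (O : (Fin N → ZMod q) → ZMod q) (x : Fin n → In) (c : Fin n → A.Coin) (v : Fin n) : Out :=
  A.output (x v) (c v) (A.finalHist G O x c v)

/-- The number of oracle queries made by all nodes together. -/
noncomputable def queryCount (A : DistAlg n N q In Out) (G : SimpleGraph (Fin n))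
    (O : (Fin N → ZMod q) → ZMod q) (x : Fin n → In) (c : Fin n → A.Coin) : ℕ :=
  ∑ v, (A.finalHist G O x c v).answers.reduceOption.length

end DistAlg

/-! ### Distributed interactive proofs -/

/-- A (possibly randomized) prover. In its rounds it sends each node a message, which may depend on
everything that was exchanged with all nodes so far. -/
structure Prover (n ℓ : ℕ) where
  Coin : Type
  [coinFintype : Fintype Coin]
  [coinNonempty : Nonempty Coin]
  msg : Coin → List (Fin n → Msg ℓ) → Fin n → Msg ℓ

attribute [instance] Prover.coinFintype Prover.coinNonempty

/-- The verifier's side of a distributed interactive proof: `rounds` alternating rounds of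
interaction with messages of `bits` bits between the prover and each node, the last one being the
prover's, and then a distributed verification algorithm without the prover. -/
structure DIP (n N q : ℕ) where
  rounds : ℕ
  bits : ℕ
  Coin : Type
  [coinFintype : Fintype Coin]
  [coinNonempty : Nonempty Coin]
  /-- the message of a node to the prover, given what it exchanged with the prover so far -/
  nodeMsg : LocalInput n q → Coin → List (Msg bits) → Msg bits
  verifier : DistAlg n N q (LocalInput n q × Coin × List (Msg bits)) Bool

attribute [instance] DIP.coinFintype DIP.coinNonempty

/-- The view of a node: its coins, all messages exchanged with the prover, and all messages
of neighbours and oracle answers received during the verification. -/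
structure NodeView {n N q : ℕ} (p : DIP n N q) where
  coin : p.Coin
  proverMsgs : List (Msg p.bits)
  verifierCoin : p.verifier.Coin
  received : LocalHist n q p.verifier.bits

/-- A simulator: a distributed algorithm without a prover that outputs a view at each node. -/
abbrev Simulator {n N q : ℕ} (p : DIP n N q) : Type 1 :=
  DistAlg n N q (LocalInput n q) (NodeView p)

namespace DIP

variable {n N d q : ℕ} [NeZero n]

/-- All coins of an execution: those of the nodes in the interaction and in the verification,
and those of the prover. -/
abbrev Coins (p : DIP n N q) (P : Prover n p.bits) : Type :=
  (Fin n → p.Coin) × (Fin n → p.verifier.Coin) × P.Coin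

/-- The messages exchanged between the prover and the nodes in the first `i` rounds (numbered from
`0`). Round `i` belongs to the prover if `rounds - i` is odd, so the rounds alternate and
the last one is the prover's. -/
def transcript (p : DIP n N q) (P : Prover n p.bits) (I : SumcheckInstance n N d q)
    (ω : p.Coins P) : ℕ → List (Fin n → Msg p.bits)
  | 0 => []
  | i + 1 =>
      let τ := transcript p P I ω i
      τ ++ [if Odd (p.rounds - i) then P.msg ω.2.2 τ
            else fun v => p.nodeMsg (I.localInput v) (ω.1 v) (τ.map (fun m => m v))]

/-- The messages exchanged between the prover and the node `v` during the whole interaction. -/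
def nodeTranscript (p : DIP n N q) (P : Prover n p.bits) (I : SumcheckInstance n N d q)
    (ω : p.Coins P) (v : Fin n) : List (Msg p.bits) :=
  (p.transcript P I ω p.rounds).map (fun m => m v)

/-- The input of the node `v` to the verification algorithm. -/
def verifierInput (p : DIP n N q) (P : Prover n p.bits) (I : SumcheckInstance n N d q)
    (ω : p.Coins P) (v : Fin n) : LocalInput n q × p.Coin × List (Msg p.bits) :=
  (I.localInput v, ω.1 v, p.nodeTranscript P I ω v)

/-- All nodes accept. -/
def Accepts (p : DIP n N q) (P : Prover n p.bits) (I : SumcheckInstance n N d q)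
    (ω : p.Coins P) : Prop :=
  ∀ v, p.verifier.out I.graph I.oracle (p.verifierInput P I ω) ω.2.1 v = true

noncomputable def acceptProb (p : DIP n N q) (P : Prover n p.bits)
    (I : SumcheckInstance n N d q) : ℝ :=
  prob {ω : p.Coins P | p.Accepts P I ω}

noncomputable def view (p : DIP n N q) (P : Prover n p.bits) (I : SumcheckInstance n N d q)
    (v : Fin n) (ω : p.Coins P) : NodeView p where
  coin := ω.1 v
  proverMsgs := p.nodeTranscript P I ω v
  verifierCoin := ω.2.1 v
  received := p.verifier.finalHist I.graph I.oracle (p.verifierInput P I ω) ω.2.1 v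

/-- The number of oracle queries of all nodes together in an execution. -/
noncomputable def queryCount (p : DIP n N q) (P : Prover n p.bits)
    (I : SumcheckInstance n N d q) (ω : p.Coins P) : ℕ :=
  p.verifier.queryCount I.graph I.oracle (p.verifierInput P I ω) ω.2.1

/-- The view of the node `v` that the simulator produces from the local inputs. -/
noncomputable def simView {p : DIP n N q} (S : Simulator p) (I : SumcheckInstance n N d q)
    (v : Fin n) (c : Fin n → S.Coin) : NodeView p :=
  S.out I.graph I.oracle I.localInput c v

/-- The number of oracle queries of all nodes together in a run of the simulator. -/
noncomputable def simQueryCount {p : DIP n N q} (S : Simulator p) (I : SumcheckInstance n N d q)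
    (c : Fin n → S.Coin) : ℕ :=
  S.queryCount I.graph I.oracle I.localInput c

end DIP

end DistSumcheck

open DistSumcheck

/-! The classical sumcheck protocol is run with every prover message spread over the tree. The round
polynomials have to pass `N + 1` linear checks (`checkForm`, `checkTarget`): one against the claimed
sum, one between each pair of consecutive polynomials, and one against a single oracle answer.
Coefficient `j` belongs to node `j mod n` and is split additively between that node and its
successor. So each check is a sum of local terms, which the nodes verify by adding up along the tree
(`sum_treeDiff`). Since partial sums would leak information, every node also adds a mask, and the
masks of a check must total zero. To test this, the prover commits to blinding values as well, and
the root's challenge contains `t` random coefficients: each total of blinding value plus coefficient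
times mask must vanish.

Soundness: all coins except the root's challenges may be fixed. A phase with nonzero total mask
survives its tests with probability at most `1 / q ^ t`. A phase with zero total mask is an ordinary
sumcheck step, which turns a false claim into a true one with probability at most `d / q`. The first
nonzero mask already decides the game, so the mask term is paid only once (`sumcheck_soundness`),
and `q ^ t ≥ 2 ^ t ≥ t`.

Completeness: the honest prover draws the subtree sums first and solves for the masks; their total
vanishes because the claim is true (`honestMaskSum_zero`).

Zero-knowledge: if `n ≥ 2`, no node holds both shares of a coefficient. The shares it holds are
uniform, and so are the subtree sums and tests revealed at nodes other than the root; the rest of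
its view is forced by acceptance. Precisely, the bijection `recoin` of the coins carries the real
view to the simulated one (`view_eq`), so their distance is zero. The function `ε` is nonzero only
for `n ≤ 1`. -/

namespace DistSumcheck

noncomputable section

/-! ### Finite uniform probability -/

section Probability

open Classical in
theorem prob_eq_sum {Ω : Type} [Fintype Ω] (E : Set Ω) :
    prob E = (∑ ω, if ω ∈ E then (1 : ℝ) else 0) / Fintype.card Ω := by
  unfold prob
  congr 1
  rw [Finset.sum_boole, Set.ncard_eq_toFinset_card']
  congr 2
  ext x; simp

theorem prob_nonneg {Ω : Type} [Fintype Ω] (E : Set Ω) : 0 ≤ prob E := by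
  unfold prob; positivity

theorem prob_mono {Ω : Type} [Fintype Ω] {E E' : Set Ω} (h : E ⊆ E') : prob E ≤ prob E' := by
  unfold prob
  gcongr
  exact Set.toFinite E'

theorem prob_univ {Ω : Type} [Fintype Ω] [Nonempty Ω] : prob (Set.univ : Set Ω) = 1 := by
  unfold prob
  rw [Set.ncard_univ, Nat.card_eq_fintype_card, div_self]
  exact_mod_cast Fintype.card_ne_zero

theorem prob_le_one {Ω : Type} [Fintype Ω] [Nonempty Ω] (E : Set Ω) : prob E ≤ 1 :=
  (prob_mono (Set.subset_univ E)).trans_eq prob_univ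

theorem prob_empty {Ω : Type} [Fintype Ω] : prob (∅ : Set Ω) = 0 := by
  simp [prob]

theorem prob_comp_bijective {Ω Ω' : Type} [Fintype Ω] [Fintype Ω'] {f : Ω → Ω'}
    (hf : Function.Bijective f) (E : Set Ω') : prob {ω | f ω ∈ E} = prob E := by
  unfold prob
  rw [Fintype.card_of_bijective hf]
  congr 2
  exact Set.ncard_preimage_of_injective_subset_range hf.1 (by simp [hf.2.range_eq])

/-- Resampling one coordinate of a uniform family leaves its distribution unchanged. -/
theorem prob_resample {ι X : Type} [Fintype ι] [DecidableEq ι] [Fintype X] [Nonempty X]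
    (i : ι) (E : Set (ι → X)) :
    prob E = (∑ x, prob {c | Function.update c i x ∈ E}) / Fintype.card X := by
  classical
  let g : (ι → X) → ℝ := fun c => if c ∈ E then 1 else 0
  have key : ∑ p : (ι → X) × X, g (Function.update p.1 i p.2) = ∑ p : (ι → X) × X, g p.1 := by
    refine Fintype.sum_bijective (fun p => (Function.update p.1 i p.2, p.1 i)) ?_ _ _ ?_
    · refine Function.Involutive.bijective fun p => ?_
      simp
    · intro p; rfl
  rw [Fintype.sum_prod_type_right, Fintype.sum_prod_type] at key
  simp only [Finset.sum_const, Finset.card_univ, nsmul_eq_mul, ← Finset.mul_sum] at key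
  have hX : (Fintype.card X : ℝ) ≠ 0 := by exact_mod_cast Fintype.card_ne_zero
  simp only [prob_eq_sum, Set.mem_ofPred_eq]
  change (∑ c, g c) / _ = (∑ x, (∑ c, g (Function.update c i x)) / _) / _
  rw [← Finset.sum_div, key]
  field_simp

theorem prob_eval {ι X : Type} [Fintype ι] [DecidableEq ι] [Fintype X] [Nonempty X]
    (i : ι) (E : Set X) : prob {c : ι → X | c i ∈ E} = prob E := by
  classical
  rw [prob_resample i, prob_eq_sum E]
  congr 1
  refine Finset.sum_congr rfl fun x _ => ?_
  simp only [Set.mem_ofPred_eq, Function.update_self]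
  split_ifs with h
  · simpa [h] using prob_univ
  · simpa [h] using prob_empty

-- One round of the soundness recursion: `B` is the set of lucky challenges, and `b` bounds the
-- success probability after any other challenge.
open Classical in
theorem average_le {X : Type} [Fintype X] [Nonempty X] {g : X → ℝ} {b : ℝ} (B : Set X)
    (h : ∀ x, g x ≤ (if x ∈ B then 1 else 0) + b) :
    (∑ x, g x) / Fintype.card X ≤ prob B + b := by
  have hX : (0 : ℝ) < Fintype.card X := by exact_mod_cast Fintype.card_pos
  rw [prob_eq_sum, div_add' _ _ _ hX.ne']
  gcongr
  calc ∑ x, g x ≤ ∑ x, ((if x ∈ B then 1 else 0) + b) := Finset.sum_le_sum fun x _ => h x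
    _ = _ := by
      rw [Finset.sum_add_distrib, Finset.sum_const, Finset.card_univ, nsmul_eq_mul, mul_comm b]

theorem average_le_of_forall_le {X : Type} [Fintype X] [Nonempty X] {g : X → ℝ} {b : ℝ}
    (h : ∀ x, g x ≤ b) : (∑ x, g x) / Fintype.card X ≤ b := by
  classical
  simpa [prob_empty] using average_le (∅ : Set X) (g := g) (b := b) (by simpa using h)

theorem prob_prod_le {Ω Ω' : Type} [Fintype Ω] [Fintype Ω'] [Nonempty Ω'] {b : ℝ}
    (E : Set (Ω × Ω')) (h : ∀ y, prob {x | (x, y) ∈ E} ≤ b) : prob E ≤ b := by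
  classical
  have : prob E = (∑ y, prob {x | (x, y) ∈ E}) / Fintype.card Ω' := by
    simp only [prob_eq_sum, Set.mem_ofPred_eq]
    rw [← Finset.sum_div, Fintype.sum_prod_type_right, Fintype.card_prod, div_div]
    push_cast; rfl
  rw [this]
  exact average_le_of_forall_le h

theorem prob_fst {Ω Ω' : Type} [Fintype Ω] [Fintype Ω'] [Nonempty Ω'] (E : Set Ω) :
    prob {p : Ω × Ω' | p.1 ∈ E} = prob E := by
  have hX : (Fintype.card Ω' : ℝ) ≠ 0 := by exact_mod_cast Fintype.card_ne_zero
  have : {p : Ω × Ω' | p.1 ∈ E} = E ×ˢ Set.univ := by ext; simp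
  unfold prob
  rw [this, Set.ncard_prod, Set.ncard_univ, Nat.card_eq_fintype_card, Fintype.card_prod]
  push_cast
  rw [mul_div_mul_right _ _ hX]

theorem prob_snd {Ω Ω' : Type} [Fintype Ω] [Fintype Ω'] [Nonempty Ω] (E : Set Ω') :
    prob {p : Ω × Ω' | p.2 ∈ E} = prob E := by
  rw [← prob_fst (Ω' := Ω) E]
  exact prob_comp_bijective (Equiv.prodComm Ω Ω').bijective {p : Ω' × Ω | p.1 ∈ E}

theorem tvDist_le_one {Ω Ω' α : Type} [Fintype Ω] [Fintype Ω'] [Nonempty Ω] [Nonempty Ω']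
    (X : Ω → α) (Y : Ω' → α) : tvDist X Y ≤ 1 := by
  refine ciSup_le fun A => ?_
  rw [abs_le]
  constructor <;>
  linarith [prob_nonneg {ω | X ω ∈ A}, prob_le_one {ω | X ω ∈ A}, prob_nonneg {ω | Y ω ∈ A},
    prob_le_one {ω | Y ω ∈ A}]

theorem tvDist_eq_zero {Ω Ω' α : Type} [Fintype Ω] [Fintype Ω'] {X : Ω → α} {Y : Ω' → α}
    (h : ∀ A : Set α, prob {ω | X ω ∈ A} = prob {ω | Y ω ∈ A}) : tvDist X Y = 0 := by
  simp [tvDist, h]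

end Probability

/-! ### Encoding elements of a finite type by bit strings -/

section Codec

variable {A : Type} [Fintype A] [Nonempty A]

open Classical in
/-- An encoding of `A` by `b` bits, injective as soon as `A` has at most `2 ^ b` elements. -/
def encode (b : ℕ) : A → Msg b :=
  if h : Nonempty (A ↪ Msg b) then h.some else fun _ _ => false

def decode {b : ℕ} (m : Msg b) : A := Function.invFun (encode b) m

theorem decode_encode {b : ℕ} (h : Fintype.card A ≤ 2 ^ b) (a : A) :
    decode (encode b a) = a := by
  have hne : Nonempty (A ↪ Msg b) := by
    rw [Function.Embedding.nonempty_iff_card_le]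
    simpa using h
  have hinj : Function.Injective (encode b : A → Msg b) := by
    unfold encode
    rw [dif_pos hne]
    exact hne.some.injective
  exact Function.leftInverse_invFun hinj a

end Codec

/-! ### Sums along a tree -/

section Tree

variable {n : ℕ} {K : Type} [Field K]

/-- The difference between the value at a node and the sum of the values at its children. -/
def treeDiff (parent : Fin n → Option (Fin n)) (s : Fin n → K) (v : Fin n) : K :=
  s v - ∑ u, if parent u = some v then s u else 0

theorem treeDiff_add (parent : Fin n → Option (Fin n)) (s s' : Fin n → K) (v : Fin n) :
    treeDiff parent (fun u => s u + s' u) v = treeDiff parent s v + treeDiff parent s' v := by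
  simp only [treeDiff, ite_add_zero, Finset.sum_add_distrib]
  ring

theorem treeDiff_mul (parent : Fin n → Option (Fin n)) (a : K) (s : Fin n → K) (v : Fin n) :
    treeDiff parent (fun u => a * s u) v = a * treeDiff parent s v := by
  simp only [treeDiff, mul_sub, Finset.mul_sum, mul_ite, mul_zero]

theorem treeDiff_sub (parent : Fin n → Option (Fin n)) (s s' : Fin n → K) (v : Fin n) :
    treeDiff parent (fun u => s u - s' u) v = treeDiff parent s v - treeDiff parent s' v := by
  have := treeDiff_add parent s (fun u => -1 * s' u) v
  rw [treeDiff_mul] at this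
  rw [sub_eq_add_neg, neg_eq_neg_one_mul, ← this]
  congr 1; funext u; ring

/-- Summation by parts: the transpose of `treeDiff` subtracts from each value the value at the
parent, or `0` at the root. -/
theorem treeDiff_mul_sum (parent : Fin n → Option (Fin n)) (s x : Fin n → K) :
    ∑ v, treeDiff parent s v * x v
      = ∑ u, s u * (x u - (parent u).elim 0 x) := by
  simp only [treeDiff, sub_mul, mul_sub, Finset.sum_sub_distrib, Finset.sum_mul]
  congr 1
  rw [Finset.sum_comm]
  refine Finset.sum_congr rfl fun u _ => ?_
  cases h : parent u with
  | none => simp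
  | some p =>
    simp only [Option.some.injEq, Option.elim, ite_mul, zero_mul]
    rw [Finset.sum_ite_eq]; simp

variable [NeZero n]

/-- Every value off the root is cancelled by the subtraction at its parent. This telescoping turns
local tests into one global equation at the root. -/
theorem sum_treeDiff {parent : Fin n → Option (Fin n)} (hroot : ∀ v, parent v = none ↔ v = 0)
    (s : Fin n → K) : ∑ v, treeDiff parent s v = s 0 := by
  have := treeDiff_mul_sum parent s (fun _ => 1)
  simp only [mul_one] at this
  rw [this, Finset.sum_eq_single 0]
  · simp [(hroot 0).2 rfl]
  · intro u _ hu
    cases h : parent u with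
    | none => exact absurd ((hroot u).1 h) hu
    | some p => simp
  · simp

theorem eq_root_of_eq_parent {β : Type} {parent : Fin n → Option (Fin n)}
    (hreach : ∀ v, Relation.ReflTransGen (fun x y => parent x = some y) v 0) {x : Fin n → β}
    (h : ∀ u v, parent u = some v → x u = x v) (v : Fin n) : x v = x 0 := by
  refine Relation.ReflTransGen.head_induction_on (hreach v) rfl ?_
  intro a b hab _ ih
  exact (h a b hab).trans ih

/-- The transpose `T` is injective: a vector in its kernel vanishes at the root and is constant
towards the root. In finite dimension it is then surjective, and surjectivity of the transpose gives
injectivity of `treeDiff`. -/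
theorem treeDiff_injective {parent : Fin n → Option (Fin n)}
    (hroot : ∀ v, parent v = none ↔ v = 0)
    (hreach : ∀ v, Relation.ReflTransGen (fun x y => parent x = some y) v 0) :
    Function.Injective (treeDiff (K := K) parent) := by
  let T : (Fin n → K) →ₗ[K] (Fin n → K) :=
    { toFun := fun x u => x u - (parent u).elim 0 x
      map_add' := by
        intro x y; funext u
        cases h : parent u <;> simp [h]; ring
      map_smul' := by
        intro a x; funext u
        cases h : parent u <;> simp [h, mul_sub] }
  have hT : Function.Injective T := by
    rw [injective_iff_map_eq_zero]
    intro x hx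
    have hx' : ∀ u, x u = (parent u).elim 0 x := fun u => sub_eq_zero.1 (congrFun hx u)
    have h0 : x 0 = 0 := by rw [hx' 0, (hroot 0).2 rfl]; rfl
    funext v
    rw [eq_root_of_eq_parent hreach (x := x) (fun u v h => by rw [hx' u, h]; rfl) v, h0]; rfl
  have hS : Function.Surjective T := LinearMap.surjective_of_injective hT
  intro s s' h
  funext u
  -- Pairing `treeDiff parent s` with this `x` reads off `s u`.
  obtain ⟨x, hx⟩ := hS (Pi.single u 1)
  have e1 := treeDiff_mul_sum parent s x
  have e2 := treeDiff_mul_sum parent s' x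
  have hx' : ∀ w, x w - (parent w).elim 0 x = (Pi.single u (1 : K) : Fin n → K) w :=
    fun w => congrFun hx w
  rw [h] at e1
  simp only [hx'] at e1 e2
  rw [e1] at e2
  simpa [Pi.single_apply] using e2

theorem treeDiff_surjective [Finite K] {parent : Fin n → Option (Fin n)}
    (hroot : ∀ v, parent v = none ↔ v = 0)
    (hreach : ∀ v, Relation.ReflTransGen (fun x y => parent x = some y) v 0) :
    Function.Surjective (treeDiff (K := K) parent) :=
  Finite.surjective_of_injective (treeDiff_injective hroot hreach)

/-- The sums of `x` over the subtrees. -/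
def treeSum (parent : Fin n → Option (Fin n)) (x : Fin n → K) : Fin n → K :=
  Function.invFun (treeDiff parent) x

theorem treeDiff_treeSum [Finite K] {parent : Fin n → Option (Fin n)}
    (hroot : ∀ v, parent v = none ↔ v = 0)
    (hreach : ∀ v, Relation.ReflTransGen (fun x y => parent x = some y) v 0) (x : Fin n → K) :
    treeDiff parent (treeSum parent x) = x :=
  Function.invFun_eq (treeDiff_surjective hroot hreach x)

theorem treeSum_root [Finite K] {parent : Fin n → Option (Fin n)}
    (hroot : ∀ v, parent v = none ↔ v = 0)
    (hreach : ∀ v, Relation.ReflTransGen (fun x y => parent x = some y) v 0) (x : Fin n → K) :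
    treeSum parent x 0 = ∑ v, x v := by
  rw [← sum_treeDiff hroot (treeSum parent x), treeDiff_treeSum hroot hreach]

end Tree

open Polynomial

/-! ### The polynomials of the sumcheck protocol -/

section Sumcheck

variable {K : Type} [Field K] {N : ℕ}

/-- The sum of `g` over the points that agree with `r` in the first `i` coordinates and have all
other coordinates in `{0, 1}`. -/
def tailSum (g : (Fin N → K) → K) (i : ℕ) (r : Fin N → K) : K :=
  -- The coordinates of `x` below `i` do not enter the summand; pinning them to `false` counts each
  -- tail once.
  ∑ x : Fin N → Bool with ∀ j : Fin N, (j : ℕ) < i → x j = false,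
    g fun j => if (j : ℕ) < i then r j else if x j then 1 else 0

theorem tailSum_zero (g : (Fin N → K) → K) (r : Fin N → K) :
    tailSum g 0 r = ∑ x : Fin N → Bool, g fun j => if x j then 1 else 0 := by
  simp [tailSum]

theorem tailSum_of_le (g : (Fin N → K) → K) {i : ℕ} (hi : N ≤ i) (r : Fin N → K) :
    tailSum g i r = g r := by
  have h : ∀ j : Fin N, (j : ℕ) < i := fun j => j.2.trans_le hi
  have : (Finset.univ.filter fun x : Fin N → Bool => ∀ j : Fin N, (j : ℕ) < i → x j = false)
      = {fun _ => false} := by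
    ext x; simp [h, funext_iff]
  rw [tailSum, this]
  simp [h]

theorem tailSum_congr (g : (Fin N → K) → K) {i : ℕ} {r r' : Fin N → K}
    (h : ∀ j : Fin N, (j : ℕ) < i → r j = r' j) : tailSum g i r = tailSum g i r' := by
  refine Finset.sum_congr rfl fun x _ => ?_
  congr 1; funext j
  split_ifs with hj <;> simp_all

theorem tailSum_succ_update (g : (Fin N → K) → K) (i : Fin N) (r : Fin N → K) (a : K) :
    tailSum g (i + 1) (Function.update r i a)
      = ∑ x : Fin N → Bool with ∀ j : Fin N, (j : ℕ) < i + 1 → x j = false,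
          g (Function.update (fun j => if (j : ℕ) < i then r j else if x j then 1 else 0) i a) := by
  refine Finset.sum_congr rfl fun x _ => ?_
  congr 1; funext j
  rcases lt_trichotomy j i with h | rfl | h
  · have h' : (j : ℕ) < i := h
    rw [Function.update_of_ne h.ne, Function.update_of_ne h.ne, if_pos h', if_pos (by omega)]
  · simp
  · have h' : (i : ℕ) < j := h
    have h1 : ¬ (j : ℕ) < i + 1 := by omega
    have h2 : ¬ (j : ℕ) < i := by omega
    rw [Function.update_of_ne h.ne', Function.update_of_ne h.ne', if_neg h1, if_neg h2]

theorem tailSum_eq_add (g : (Fin N → K) → K) (i : Fin N) (r : Fin N → K) :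
    tailSum g i r = tailSum g (i + 1) (Function.update r i 0)
      + tailSum g (i + 1) (Function.update r i 1) := by
  rw [tailSum_succ_update, tailSum_succ_update, tailSum,
    ← Finset.sum_filter_add_sum_filter_not _ (fun x => x i = false), Finset.filter_filter,
    Finset.filter_filter]
  congr 1
  · refine Finset.sum_congr ?_ fun x hx => ?_
    · ext x
      simp only [Finset.mem_filter, Finset.mem_univ, true_and]
      constructor
      · rintro ⟨h, hi⟩ j hj
        rcases Nat.lt_succ_iff_lt_or_eq.1 hj with h' | h'
        · exact h j h'
        · rwa [Fin.ext h']
      · exact fun h => ⟨fun j hj => h j (by omega), h i (by omega)⟩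
    · simp only [Finset.mem_filter, Finset.mem_univ, true_and] at hx
      congr 1; funext j
      by_cases hj : j = i
      · subst hj; simp [hx (j) (by omega)]
      · simp [hj]
  -- The half with `x i = true` is reindexed, because the sum at `i + 1` pins coordinate `i` to
  -- `false`.
  · refine Finset.sum_nbij' (fun x => Function.update x i false)
      (fun x => Function.update x i true) ?_ ?_ ?_ ?_ ?_
    · intro x hx
      simp only [Finset.mem_filter, Finset.mem_univ, true_and] at hx ⊢
      intro j hj
      by_cases h : j = i
      · subst h; simp
      · have : (j : ℕ) ≠ i := fun h' => h (Fin.ext h')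
        simp [h, hx.1 j (by omega)]
    · intro x hx
      simp only [Finset.mem_filter, Finset.mem_univ, true_and] at hx ⊢
      refine ⟨fun j hj => ?_, by simp⟩
      have h : j ≠ i := by rintro rfl; omega
      simp [h, hx j (by omega)]
    · intro x hx
      simp only [Finset.mem_filter, Finset.mem_univ, true_and] at hx
      have : x i = true := by simpa using hx.2
      simp [← this]
    · intro x hx
      simp only [Finset.mem_filter, Finset.mem_univ, true_and] at hx
      have : x i = false := hx i (by omega)
      simp [← this]
    · intro x hx
      simp only [Finset.mem_filter, Finset.mem_univ, true_and] at hx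
      have : x i = true := by simpa using hx.2
      congr 1; funext j
      by_cases hj : j = i
      · subst hj; simp [this]
      · simp [hj]

/-- `g` is a polynomial function of degree at most `d` in each variable. -/
def IsPolyOfDegree (d : ℕ) (g : (Fin N → K) → K) : Prop :=
  ∀ (i : Fin N) (r : Fin N → K),
    ∃ p : K[X], p.natDegree ≤ d ∧ ∀ a, p.eval a = g (Function.update r i a)

theorem isPolyOfDegree_eval {d : ℕ} {F : MvPolynomial (Fin N) K} (h : ∀ i, F.degreeOf i ≤ d) :
    IsPolyOfDegree d fun x => MvPolynomial.eval x F := by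
  intro i r
  -- Substitute `X` for the `i`-th variable and the constants `r j` for the others.
  refine ⟨∑ m ∈ F.support, C (F.coeff m) * ∏ j, (Function.update (fun j => C (r j)) i X j) ^ m j,
    ?_, fun a => ?_⟩
  · refine natDegree_sum_le_of_forall_le _ _ fun m hm => ?_
    refine (natDegree_C_mul_le _ _).trans ?_
    refine (natDegree_prod_le _ _).trans ?_
    rw [Finset.sum_eq_single i]
    · simp only [Function.update_self, natDegree_X_pow]
      exact (MvPolynomial.monomial_le_degreeOf i hm).trans (h i)
    · intro j _ hj
      simp only [Function.update_of_ne hj]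
      rw [← C_pow, natDegree_C]
    · simp
  · change _ = MvPolynomial.eval _ F
    rw [MvPolynomial.eval_eq', eval_finsetSum]
    refine Finset.sum_congr rfl fun m _ => ?_
    rw [eval_mul, eval_C, eval_prod]
    congr 1
    refine Finset.prod_congr rfl fun j _ => ?_
    rw [eval_pow]
    congr 1
    by_cases hj : j = i
    · subst hj; simp
    · simp [hj]

theorem IsPolyOfDegree.tailSum {d : ℕ} {g : (Fin N → K) → K} (h : IsPolyOfDegree d g)
    (i : Fin N) (r : Fin N → K) : ∃ p : K[X], p.natDegree ≤ d ∧
      ∀ a, p.eval a = DistSumcheck.tailSum g (i + 1) (Function.update r i a) := by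
  choose p hp hpe using h
  refine ⟨∑ x : Fin N → Bool with ∀ j : Fin N, (j : ℕ) < i + 1 → x j = false,
    p i fun j => if (j : ℕ) < i then r j else if x j then 1 else 0, ?_, fun a => ?_⟩
  · exact natDegree_sum_le_of_forall_le _ _ fun _ _ => hp _ _
  · rw [tailSum_succ_update, eval_finsetSum]
    exact Finset.sum_congr rfl fun _ _ => hpe _ _ _

open Classical in
/-- A polynomial of degree at most `d` that represents the function `g`, if there is one. -/
def polyOf (d : ℕ) (g : K → K) : K[X] :=
  if h : ∃ p : K[X], p.natDegree ≤ d ∧ ∀ a, p.eval a = g a then h.choose else 0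

theorem natDegree_polyOf_le (d : ℕ) (g : K → K) : (polyOf d g).natDegree ≤ d := by
  unfold polyOf
  split_ifs with h
  · exact h.choose_spec.1
  · simp

theorem eval_polyOf {d : ℕ} {g : K → K} (h : ∃ p : K[X], p.natDegree ≤ d ∧ ∀ a, p.eval a = g a)
    (a : K) : (polyOf d g).eval a = g a := by
  unfold polyOf
  rw [dif_pos h]
  exact h.choose_spec.2 a

/-- The `i`-th polynomial of the honest prover in the sumcheck protocol. -/
def roundPoly (d : ℕ) (g : (Fin N → K) → K) (r : Fin N → K) (i : ℕ) : K[X] :=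
  if h : i < N then polyOf d fun a => tailSum g (i + 1) (Function.update r ⟨i, h⟩ a) else 0

theorem natDegree_roundPoly_le (d : ℕ) (g : (Fin N → K) → K) (r : Fin N → K) (i : ℕ) :
    (roundPoly d g r i).natDegree ≤ d := by
  unfold roundPoly
  split_ifs
  · exact natDegree_polyOf_le _ _
  · simp

theorem eval_roundPoly {d : ℕ} {g : (Fin N → K) → K} (hg : IsPolyOfDegree d g)
    (r : Fin N → K) (i : Fin N) (a : K) :
    (roundPoly d g r i).eval a = tailSum g (i + 1) (Function.update r i a) := by
  rw [roundPoly, dif_pos i.2]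
  exact eval_polyOf (hg.tailSum i r) a

theorem roundPoly_congr (d : ℕ) (g : (Fin N → K) → K) {r r' : Fin N → K} {i : ℕ}
    (h : ∀ j : Fin N, (j : ℕ) < i → r j = r' j) : roundPoly d g r i = roundPoly d g r' i := by
  unfold roundPoly
  split_ifs with hi
  · congr 1; funext a
    refine tailSum_congr g fun j hj => ?_
    by_cases hji : j = ⟨i, hi⟩
    · subst hji; simp
    · have : (j : ℕ) ≠ i := fun h' => hji (Fin.ext h')
      simp [hji, h j (by omega)]
  · rfl

/-- The linear form of the `i`-th check, for polynomials `P` and challenges `r`: the sum of the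
values of `P i` at `0` and `1` minus the value of `P (i - 1)` at the last challenge. -/
def checkForm (N i : ℕ) (P : ℕ → K[X]) (r : ℕ → K) : K :=
  (if i < N then (P i).eval 0 + (P i).eval 1 else 0)
    - (if 0 < i then (P (i - 1)).eval (r (i - 1)) else 0)

/-- The value that the linear form of the `i`-th check should have. -/
def checkTarget (N i : ℕ) (a b : K) : K :=
  (if i = 0 then a else 0) - (if i = N then b else 0)

theorem checkForm_sum {ι : Type} (s : Finset ι) (N i : ℕ) (P : ι → ℕ → K[X]) (r : ℕ → K) :
    checkForm N i (fun j => ∑ v ∈ s, P v j) r = ∑ v ∈ s, checkForm N i (P v) r := by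
  simp only [checkForm, eval_finsetSum, Finset.sum_sub_distrib, ← Finset.sum_add_distrib]
  congr 1 <;> split_ifs <;> simp

theorem checkForm_congr {N i : ℕ} {P P' : ℕ → K[X]} {r r' : ℕ → K} (h1 : P i = P' i)
    (h2 : P (i - 1) = P' (i - 1)) (h3 : 0 < i → r (i - 1) = r' (i - 1)) :
    checkForm N i P r = checkForm N i P' r' := by
  unfold checkForm
  rw [h1, h2]
  congr 1
  split_ifs with h
  · rw [h3 h]
  · rfl

/-- Both halves of the form equal `tailSum g i r`. They cancel for `0 < i < N`; at the two ends only
one is present, which leaves `a` and `-g r`. -/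
theorem checkForm_roundPoly {d : ℕ} {g : (Fin N → K) → K} (hg : IsPolyOfDegree d g) {a : K}
    (ha : ∑ x : Fin N → Bool, g (fun j => if x j then 1 else 0) = a) (r : Fin N → K)
    {ρ : ℕ → K} (hρ : ∀ j : Fin N, ρ j = r j) {i : ℕ} (hi : i ≤ N) :
    checkForm N i (roundPoly d g r) ρ = checkTarget N i a (g r) := by
  have h1 : (if i < N then (roundPoly d g r i).eval 0 + (roundPoly d g r i).eval 1 else 0)
      = if i < N then tailSum g i r else 0 := by
    split_ifs with h
    · rw [eval_roundPoly hg r ⟨i, h⟩, eval_roundPoly hg r ⟨i, h⟩]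
      exact (tailSum_eq_add g ⟨i, h⟩ r).symm
    · rfl
  have h2 : (if 0 < i then (roundPoly d g r (i - 1)).eval (ρ (i - 1)) else 0)
      = if 0 < i then tailSum g i r else 0 := by
    split_ifs with h
    · have hi' : i - 1 < N := by omega
      have e := eval_roundPoly hg r ⟨i - 1, hi'⟩ (ρ (i - 1))
      rw [hρ ⟨i - 1, hi'⟩, Function.update_eq_self] at e
      simp only [Nat.sub_add_cancel h] at e
      rw [← e, ← hρ ⟨i - 1, hi'⟩]
    · rfl
  rw [checkForm, h1, h2, checkTarget]
  rcases Nat.eq_zero_or_pos i with rfl | h0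
  · have e0 : tailSum g 0 r = a := (tailSum_zero g r).trans ha
    rcases Nat.eq_zero_or_pos N with rfl | hN
    · rw [← tailSum_of_le g le_rfl r, e0]; simp
    · simp [hN, hN.ne, e0]
  · rcases hi.lt_or_eq with h | rfl
    · simp [h0, h0.ne', h, h.ne]
    · simp [h0, h0.ne', tailSum_of_le]

end Sumcheck

/-! ### Soundness of the sumcheck protocol with masked checks -/

section Game

variable {K : Type} {N t : ℕ}

/-- A challenge: the value of one variable, and the coefficients of the mask test. -/
abbrev Challenge (K : Type) (t : ℕ) : Type := K × (Fin t → K)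

/-- The values of the variables that a sequence of challenges determines. -/
def point (c : Fin (N + 1) → Challenge K t) (j : Fin N) : K := (c j.castSucc).1

def value (c : Fin (N + 1) → Challenge K t) (j : ℕ) : K := (c (Fin.ofNat (N + 1) j)).1

theorem value_fin (c : Fin (N + 1) → Challenge K t) (j : Fin N) : value c j = point c j := by
  unfold value point
  congr 2
  ext
  simp

/-- Follow `c₀` for the first `i` challenges and `c` afterwards. -/
def splice (i : ℕ) (c₀ c : Fin (N + 1) → Challenge K t) : Fin (N + 1) → Challenge K t :=
  fun j => if (j : ℕ) < i then c₀ j else c j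

/-- A resampled challenge moves into the fixed prefix, which is the induction step of the soundness
game. -/
theorem splice_update (i : Fin (N + 1)) (c₀ c : Fin (N + 1) → Challenge K t) (x : Challenge K t) :
    splice i c₀ (Function.update c i x) = splice (i + 1) (Function.update c₀ i x) c := by
  funext j
  unfold splice
  rcases lt_trichotomy j i with h | rfl | h
  · have : (j : ℕ) < i := h
    simp [h.ne, this, this.trans (Nat.lt_succ_self _)]
  · simp
  · have h' : (i : ℕ) < j := h
    have h1 : ¬ (j : ℕ) < i + 1 := by omega
    have h2 : ¬ (j : ℕ) < i := by omega
    simp [h.ne', h1, h2]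

variable [Field K] [Fintype K]

theorem prob_root_le {t : ℕ} {f p : K[X]} {d : ℕ} (hf : f.natDegree ≤ d) (hp : p.natDegree ≤ d)
    (hne : f ≠ p) : prob {x : Challenge K t | f.eval x.1 = p.eval x.1} ≤ d / Fintype.card K := by
  classical
  refine (prob_fst (Ω' := Fin t → K) {x : K | f.eval x = p.eval x}).trans_le ?_
  unfold prob
  gcongr
  have hsub : {x : K | f.eval x = p.eval x} ⊆ ((f - p).roots.toFinset : Set K) := by
    intro x hx
    have : f.eval x = p.eval x := hx
    simp [sub_ne_zero.2 hne, this]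
  refine (Set.ncard_le_ncard hsub (Finset.finite_toSet _)).trans ?_
  rw [Set.ncard_coe_finset]
  refine (Multiset.toFinset_card_le _).trans ((card_roots' _).trans ?_)
  exact (natDegree_sub_le _ _).trans (max_le hf hp)

/-- For `y ≠ 0` a single vector of coefficients, `-z l / y`, passes all tests. -/
theorem prob_mask_le {t : ℕ} (z : Fin t → K) {y : K} (hy : y ≠ 0) :
    prob {x : Challenge K t | ∀ l, z l + x.2 l * y = 0} ≤ 1 / (Fintype.card K : ℝ) ^ t := by
  classical
  refine (prob_mono (E' := {x : Challenge K t | x.2 ∈ ({fun l => -z l / y} : Set _)}) ?_).trans ?_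
  · intro x hx
    have hx' : ∀ l, z l + x.2 l * y = 0 := hx
    change x.2 = _
    funext l
    rw [eq_div_iff hy]
    linear_combination hx' l
  · rw [prob_snd]
    simp [prob]

/-- Here `f`, `y` and `z` are the totals over all nodes of the committed polynomials, masks and
blinding values. By `hcongr`, those of phase `i` are fixed before challenge `i` is drawn. -/
theorem sumcheck_soundness {d : ℕ} {g : (Fin N → K) → K} (hg : IsPolyOfDegree d g) {a : K}
    (ha : ∑ x : Fin N → Bool, g (fun j => if x j then 1 else 0) ≠ a)
    (E : Set (Fin (N + 1) → Challenge K t))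
    (f : ℕ → (Fin (N + 1) → Challenge K t) → K[X]) (y : ℕ → (Fin (N + 1) → Challenge K t) → K)
    (z : ℕ → (Fin (N + 1) → Challenge K t) → Fin t → K)
    (hdeg : ∀ i c, (f i c).natDegree ≤ d)
    (hcongr : ∀ i c c', (∀ j : Fin (N + 1), (j : ℕ) < i → c j = c' j) →
      f i c = f i c' ∧ y i c = y i c' ∧ z i c = z i c')
    (hcheck : ∀ c ∈ E, ∀ i ≤ N, checkForm N i (fun j => f j c) (value c) + y i c
      = checkTarget N i a (g (point c)))
    (hmask : ∀ c ∈ E, ∀ (i : Fin (N + 1)) (l : Fin t), z i c l + (c i).2 l * y i c = 0) :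
    prob E ≤ N * d / Fintype.card K + 1 / (Fintype.card K : ℝ) ^ t := by
  classical
  -- The value that the prover has to justify from phase `i` on.
  let claim : ℕ → (Fin (N + 1) → Challenge K t) → K := fun i c =>
    if i = 0 then a else (f (i - 1) c).eval (value c (i - 1))
  have hsplice : ∀ i (c₀ c : Fin (N + 1) → Challenge K t), ∀ j : Fin (N + 1), (j : ℕ) < i → splice i c₀ c j = c₀ j :=
    fun i c₀ c j hj => by simp [splice, hj]
  have hclaim : ∀ i ≤ N, ∀ c c', (∀ j : Fin (N + 1), (j : ℕ) < i → c j = c' j) →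
      claim i c = claim i c' := by
    intro i hi c c' h
    simp only [claim]
    split_ifs with h0
    · rfl
    · rw [(hcongr (i - 1) c c' fun j hj => h j (by omega)).1]
      have : value c (i - 1) = value c' (i - 1) := by
        unfold value
        rw [h]
        simp only [Fin.val_ofNat]
        rw [Nat.mod_eq_of_lt (by omega)]; omega
      rw [this]
  have hpoint : ∀ i, ∀ c c' : Fin (N + 1) → Challenge K t,
      (∀ j : Fin (N + 1), (j : ℕ) < i → c j = c' j) →
      ∀ j : Fin N, (j : ℕ) < i → point c j = point c' j := by
    intro i c c' h j hj
    unfold point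
    rw [h j.castSucc (by simpa using hj)]
  have hlt : ∀ c ∈ E, ∀ i < N, (f i c).eval 0 + (f i c).eval 1 + y i c = claim i c := by
    intro c hc i hi
    have := hcheck c hc i hi.le
    rcases Nat.eq_zero_or_pos i with rfl | h0
    · simpa [checkForm, checkTarget, claim, hi, hi.ne] using this
    · simp only [checkForm, checkTarget, hi, if_true, h0, h0.ne', hi.ne, if_false] at this
      simp only [claim, h0.ne', if_false]
      linear_combination this
  have heq : ∀ c ∈ E, g (point c) + y N c = claim N c := by
    intro c hc
    have := hcheck c hc N le_rfl
    rcases Nat.eq_zero_or_pos N with h0 | h0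
    · simp only [checkForm, checkTarget, claim, h0] at this ⊢
      simp at this ⊢
      linear_combination this
    · simp only [checkForm, checkTarget, lt_irrefl, if_true, h0, h0.ne', if_false] at this
      simp only [claim, h0.ne', if_false]
      linear_combination this
  -- Induction on the number `k` of variables still to be drawn, for a prefix after which the
  -- current claim is false.
  have main : ∀ k i, i + k = N → ∀ c₀, claim i c₀ ≠ tailSum g i (point c₀) →
      prob {c | splice i c₀ c ∈ E} ≤ k * d / Fintype.card K + 1 / (Fintype.card K : ℝ) ^ t := by
    intro k
    induction k with
    | zero => ?_
    | succ k ih => ?_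
    all_goals
      intro i hik c₀ hbad
      have hiN : i < N + 1 := by omega
      have hres := prob_resample (⟨i, hiN⟩ : Fin (N + 1)) {c | splice i c₀ c ∈ E}
      simp only [Set.mem_ofPred_eq, splice_update ⟨i, hiN⟩] at hres
      have hpre : ∀ c, f i (splice i c₀ c) = f i c₀ ∧ y i (splice i c₀ c) = y i c₀ ∧
          z i (splice i c₀ c) = z i c₀ := fun c => hcongr i _ _ (hsplice i c₀ c)
      have hcl : ∀ c, claim i (splice i c₀ c) = claim i c₀ := fun c =>
        hclaim i (by omega) _ _ (hsplice i c₀ c)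
      -- A nonzero mask bounds the whole remaining game by `1 / q ^ t` without recursion, so this
      -- term does not accumulate over the phases.
      by_cases hy : y i c₀ = 0
      swap
      · have : prob {c | splice i c₀ c ∈ E} ≤ 1 / (Fintype.card K : ℝ) ^ t := by
          rw [hres]
          refine (average_le {x : Challenge K t | ∀ l, z i c₀ l + x.2 l * y i c₀ = 0}
            (b := 0) fun x => ?_).trans (by rw [add_zero]; exact prob_mask_le _ hy)
          split_ifs with hx
          · simpa using prob_le_one _
          · rw [add_zero, Set.eq_empty_of_forall_notMem
              (s := {c | splice (i + 1) (Function.update c₀ ⟨i, hiN⟩ x) c ∈ E}), prob_empty]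
            refine fun c hc => hx fun l => ?_
            have hm := hmask _ hc ⟨i, hiN⟩ l
            have h3 := hcongr i (splice (i + 1) (Function.update c₀ ⟨i, hiN⟩ x) c) c₀ (by
              intro j hj
              rw [hsplice _ _ _ j (by omega), Function.update_of_ne]
              rintro rfl; simp at hj)
            rw [h3.2.1, h3.2.2, hsplice _ _ _ _ (by simp), Function.update_self] at hm
            exact hm
        refine this.trans (le_add_of_nonneg_left (by positivity))
    -- All variables are fixed: with zero mask, the last check equates the claim with the true
    -- value, so acceptance is impossible.
    · have hi : i = N := by omega
      subst hi
      have : {c | splice i c₀ c ∈ E} = ∅ := by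
        refine Set.eq_empty_of_forall_notMem fun c hc => hbad ?_
        have := heq _ hc
        rw [(hpre c).2.1, hy, add_zero, hcl c] at this
        rw [← this, tailSum_of_le g le_rfl]
        congr 1; funext j
        exact hpoint i _ _ (hsplice i c₀ c) j j.2
      rw [this, prob_empty]
      positivity
    -- If some continuation is accepted, its `i`-th check is an identity about the prefix alone. It
    -- shows that the committed polynomial differs from the true one.
    · by_cases hne : ∃ c, splice i c₀ c ∈ E
      swap
      · have : {c | splice i c₀ c ∈ E} = ∅ :=
          Set.eq_empty_of_forall_notMem fun c hc => hne ⟨c, hc⟩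
        rw [this, prob_empty]
        positivity
      obtain ⟨c₁, hc₁⟩ := hne
      have hi : i < N := by omega
      have hsum := hlt _ hc₁ i hi
      rw [(hpre c₁).1, (hpre c₁).2.1, hcl c₁, hy, add_zero] at hsum
      have hfp : f i c₀ ≠ roundPoly d g (point c₀) i := by
        intro h
        rw [h, eval_roundPoly hg _ ⟨i, hi⟩, eval_roundPoly hg _ ⟨i, hi⟩] at hsum
        exact hbad (hsum.symm.trans (tailSum_eq_add g ⟨i, hi⟩ (point c₀)).symm)
      rw [hres]
      have hcast : ((k + 1 : ℕ) : ℝ) * d / Fintype.card K + 1 / (Fintype.card K : ℝ) ^ t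
          = d / Fintype.card K + (k * d / Fintype.card K + 1 / (Fintype.card K : ℝ) ^ t) := by
        push_cast; ring
      rw [hcast]
      -- The lucky challenges are those at which the two distinct polynomials agree; after any
      -- other, the next claim is false too.
      refine (average_le {x : Challenge K t |
          (f i c₀).eval x.1 = (roundPoly d g (point c₀) i).eval x.1}
        (b := k * d / Fintype.card K + 1 / (Fintype.card K : ℝ) ^ t) fun x => ?_).trans
        (add_le_add_left (prob_root_le (hdeg i c₀) (natDegree_roundPoly_le _ _ _ _) hfp) _)
      split_ifs with hx
      · refine (prob_le_one _).trans (le_add_of_nonneg_right (by positivity))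
      · rw [zero_add]
        refine ih (i + 1) (by omega) _ fun h => hx ?_
        have hupd : ∀ j : Fin (N + 1), (j : ℕ) < i →
            Function.update c₀ ⟨i, hiN⟩ x j = c₀ j := by
          intro j hj
          rw [Function.update_of_ne]
          rintro rfl; simp at hj
        have hv : value (Function.update c₀ ⟨i, hiN⟩ x) i = x.1 := by
          unfold value
          have : Fin.ofNat (N + 1) i = ⟨i, hiN⟩ := by
            ext; simp [Nat.mod_eq_of_lt hiN]
          rw [this, Function.update_self]
        simp only [claim, Nat.succ_ne_zero, if_false, Nat.add_sub_cancel, hv] at h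
        rw [(hcongr i _ _ hupd).1] at h
        change (f i c₀).eval x.1 = _
        rw [h, eval_roundPoly hg _ ⟨i, hi⟩]
        refine tailSum_congr g fun j hj => ?_
        by_cases hji : j = ⟨i, hi⟩
        · subst hji
          simp only [Function.update_self]
          rw [← hv, ← value_fin]
        · have : (j : ℕ) ≠ i := fun h' => hji (Fin.ext h')
          rw [Function.update_of_ne hji]
          exact hpoint i _ _ hupd j (by omega)
  have h0 := main N 0 (zero_add N) (fun _ => 0) (by
    rw [tailSum_zero]; exact fun h => ha h.symm)
  have hall : ∀ c : Fin (N + 1) → Challenge K t, splice 0 (fun _ => 0) c = c := fun c => by funext j; simp [splice]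
  simpa only [hall, Set.ofPred_mem_eq] using h0

end Game

/-! ### Distributed algorithms with one round and at most one query, made by the root -/

section OneRound

variable {n N q : ℕ} [NeZero n] {In Out : Type}

-- The condition `h.inbox = []` confines queries to the stage before the only round, hence the
-- second answer is `none`.
open Classical in
theorem finalHist_of_rounds_eq_one (A : DistAlg n N q In Out) (hA : A.rounds = 1)
    (ident : In → Fin n) (pt : In → A.Coin → Fin N → ZMod q)
    (hq : ∀ x c h, A.query x c h = if ident x = 0 ∧ h.inbox = [] then some (pt x c) else none)
    (G : SimpleGraph (Fin n)) (O : (Fin N → ZMod q) → ZMod q) (x : Fin n → In)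
    (hx : ∀ v, ident (x v) = v) (c : Fin n → A.Coin) (v : Fin n) :
    A.finalHist G O x c v =
      ⟨[if v = 0 then some (O (pt (x v) (c v))) else none, none],
        [fun u => if G.Adj u v then some (A.send (x u) (c u)
          ⟨[if u = 0 then some (O (pt (x u) (c u))) else none], []⟩ v) else none]⟩ := by
  have hask : ∀ u, A.ask O (x u) (c u) ⟨[], []⟩
      = ⟨[if u = 0 then some (O (pt (x u) (c u))) else none], []⟩ := by
    intro u
    simp only [DistAlg.ask, hq, hx]
    by_cases hu : u = 0 <;> simp [hu]
  have h1 : A.hist G O x c 1 v = ⟨[if v = 0 then some (O (pt (x v) (c v))) else none],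
        [fun u => if G.Adj u v then some (A.send (x u) (c u)
          ⟨[if u = 0 then some (O (pt (x u) (c u))) else none], []⟩ v) else none]⟩ := by
    simp only [DistAlg.hist, hask, List.nil_append]
  rw [DistAlg.finalHist, hA, h1]
  simp [DistAlg.ask, hq]

theorem queryCount_of_rounds_eq_one (A : DistAlg n N q In Out) (hA : A.rounds = 1)
    (ident : In → Fin n) (pt : In → A.Coin → Fin N → ZMod q)
    (hq : ∀ x c h, A.query x c h = if ident x = 0 ∧ h.inbox = [] then some (pt x c) else none)
    (G : SimpleGraph (Fin n)) (O : (Fin N → ZMod q) → ZMod q) (x : Fin n → In)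
    (hx : ∀ v, ident (x v) = v) (c : Fin n → A.Coin) :
    A.queryCount G O x c = 1 := by
  unfold DistAlg.queryCount
  simp only [finalHist_of_rounds_eq_one A hA ident pt hq G O x hx c]
  rw [Finset.sum_eq_single 0]
  · simp [List.reduceOption]
  · intro v _ hv
    simp [hv, List.reduceOption]
  · simp

end OneRound

/-! ### The messages of the protocol -/

section Messages

/-- What the prover commits to at a node in one phase: two blocks of shares of coefficients, the
mask of the next check, and the values that blind the test of the mask. -/
@[ext] structure Commit (K : Type) (m t : ℕ) where
  left : Fin m → K
  right : Fin m → K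
  mask : K
  blind : Fin t → K

/-- What the prover reveals to a node in one phase: the challenge of the root, and the sums over the
subtree of the node in the masked check and in the tests of the mask. -/
@[ext] structure Reveal (K : Type) (t : ℕ) where
  chal : Challenge K t
  sum : K
  test : Fin t → K

variable {K : Type} {m t : ℕ}

def Commit.equivProd : Commit K m t ≃ (Fin m → K) × (Fin m → K) × K × (Fin t → K) where
  toFun c := (c.left, c.right, c.mask, c.blind)
  invFun p := ⟨p.1, p.2.1, p.2.2.1, p.2.2.2⟩
  left_inv _ := rfl
  right_inv _ := rfl

def Reveal.equivProd : Reveal K t ≃ Challenge K t × K × (Fin t → K) where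
  toFun c := (c.chal, c.sum, c.test)
  invFun p := ⟨p.1, p.2.1, p.2.2⟩
  left_inv _ := rfl
  right_inv _ := rfl

instance [Fintype K] : Fintype (Commit K m t) := Fintype.ofEquiv _ Commit.equivProd.symm

instance [Fintype K] : Fintype (Reveal K t) := Fintype.ofEquiv _ Reveal.equivProd.symm

instance [Zero K] : Inhabited (Commit K m t) := ⟨⟨0, 0, 0, 0⟩⟩

instance [Zero K] : Inhabited (Reveal K t) := ⟨⟨0, 0, 0⟩⟩

theorem card_commit [Fintype K] :
    Fintype.card (Commit K m t) = Fintype.card K ^ (2 * m + t + 1) := by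
  rw [Fintype.card_congr Commit.equivProd]
  simp only [Fintype.card_prod, Fintype.card_fun, Fintype.card_fin]
  ring

theorem card_reveal [Fintype K] : Fintype.card (Reveal K t) = Fintype.card K ^ (2 * t + 2) := by
  rw [Fintype.card_congr Reveal.equivProd]
  simp only [Fintype.card_prod, Fintype.card_fun, Fintype.card_fin]
  ring

end Messages

/-! ### The protocol -/

section Protocol

/-- The number of coefficients of a polynomial of degree at most `d` that each of `n` nodes has to
take care of. -/
abbrev slots (n d : ℕ) : ℕ := d / n + 1

/-- The number of bits of an element of `ZMod q`. -/
abbrev width (q : ℕ) : ℕ := Nat.log 2 q + 1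

abbrev proverBits (n d t q : ℕ) : ℕ := (2 * slots n d + 3 * t + 3) * width q

abbrev nodeBits (N t q : ℕ) : ℕ := (2 * t + 2) * (N + 1) * width q + 1

abbrev ProverMsg (n d t q : ℕ) : Type := Commit (ZMod q) (slots n d) t × Reveal (ZMod q) t

abbrev NodeMsg (N t q : ℕ) : Type := Option (Fin (N + 1) → Reveal (ZMod q) t)

theorem card_pow_le (q : ℕ) [Fact q.Prime] (k : ℕ) :
    Fintype.card (ZMod q) ^ k ≤ 2 ^ (k * width q) := by
  rw [ZMod.card, mul_comm, pow_mul]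
  exact Nat.pow_le_pow_left (Nat.lt_pow_succ_log_self (by norm_num) q).le k

theorem card_proverMsg_le (n d t q : ℕ) [Fact q.Prime] :
    Fintype.card (ProverMsg n d t q) ≤ 2 ^ proverBits n d t q := by
  rw [Fintype.card_prod, card_commit, card_reveal, ← pow_add]
  refine (card_pow_le q _).trans (Nat.pow_le_pow_right (by norm_num) ?_)
  exact Nat.mul_le_mul_right _ (by omega)

theorem card_challenge_le (n d t q : ℕ) [Fact q.Prime] :
    Fintype.card (Challenge (ZMod q) t) ≤ 2 ^ proverBits n d t q := by
  rw [Fintype.card_prod, Fintype.card_fun, Fintype.card_fin, ← pow_succ']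
  refine (card_pow_le q _).trans (Nat.pow_le_pow_right (by norm_num) ?_)
  exact Nat.mul_le_mul_right _ (by omega)

theorem card_nodeMsg_le (N t q : ℕ) [Fact q.Prime] :
    Fintype.card (NodeMsg N t q) ≤ 2 ^ nodeBits N t q := by
  rw [Fintype.card_option, Fintype.card_fun, Fintype.card_fin, card_reveal, ← pow_mul, pow_succ]
  have h := card_pow_le q ((2 * t + 2) * (N + 1))
  have h1 : 1 ≤ 2 ^ ((2 * t + 2) * (N + 1) * width q) := Nat.one_le_two_pow
  omega

/-- The monomial `X ^ j`, cut off above degree `d`. -/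
def cutMonomial (q d j : ℕ) : (ZMod q)[X] := if j ≤ d then X ^ j else 0

/-- The contribution of a node to the polynomial of a phase: it holds shares of its own coefficients
and of those of its predecessor. -/
def sharePoly {n : ℕ} [NeZero n] {q : ℕ} (d : ℕ) {m : ℕ} (v : Fin n)
    (left right : Fin m → ZMod q) : (ZMod q)[X] :=
  ∑ k, C (left k) * cutMonomial q d (v + n * k)
    + ∑ k, C (right k) * cutMonomial q d ((v - 1 : Fin n) + n * k)

/-- Because of the cut-off in `cutMonomial` this holds for arbitrary shares, so a cheating prover
cannot exceed the degree and no degree test is needed. -/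
theorem natDegree_sharePoly_le {n : ℕ} [NeZero n] {q : ℕ} (d : ℕ) {m : ℕ} (v : Fin n)
    (left right : Fin m → ZMod q) : (sharePoly d v left right).natDegree ≤ d := by
  have h : ∀ (a : ZMod q) (j : ℕ), (C a * cutMonomial q d j).natDegree ≤ d := by
    intro a j
    unfold cutMonomial
    split_ifs with hj
    · exact (natDegree_C_mul_X_pow_le a j).trans hj
    · simp
  refine natDegree_add_le_of_degree_le ?_ ?_ <;>
  exact natDegree_sum_le_of_forall_le _ _ fun k _ => h _ _

variable {n N d t q : ℕ} [NeZero n] [Fact q.Prime]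

/-- The test that a node makes at the end: `c` are its coins, `commit` and `reveal` what it got from
the prover, `kids` what its children told it, and `ans` is the oracle's answer. -/
def NodeCheck (d : ℕ) (x : LocalInput n q) (c : Fin (N + 1) → Challenge (ZMod q) t)
    (commit : ℕ → Commit (ZMod q) (slots n d) t) (reveal : ℕ → Reveal (ZMod q) t)
    (kids : Fin n → NodeMsg N t q) (ans : ZMod q) : Prop :=
  (x.id = 0 → ∀ i : Fin (N + 1), (reveal i).chal = c i ∧
    (reveal i).sum = checkTarget N i x.target ans ∧ ∀ l, (reveal i).test l = 0) ∧
  (∀ u r, kids u = some r → ∀ i : Fin (N + 1), (r i).chal = (reveal i).chal) ∧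
  ∀ i : Fin (N + 1),
    ((reveal i).sum = checkForm N i (fun j => sharePoly d x.id (commit j).left (commit j).right)
        (fun j => (reveal j).chal.1) + (commit i).mask
        + ∑ u, (kids u).elim 0 fun r => (r i).sum) ∧
    ∀ l, (reveal i).test l = (commit i).blind l + (reveal i).chal.2 l * (commit i).mask
        + ∑ u, (kids u).elim 0 fun r => (r i).test l

/-- The commitments in the list of all messages that a node exchanged with the prover. -/
def commitOf (n d t q : ℕ) [Fact q.Prime] (τ : List (Msg (proverBits n d t q))) (i : ℕ) :
    Commit (ZMod q) (slots n d) t :=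
  (decode (τ.getD (2 * i) fun _ => false) : ProverMsg n d t q).1

/-- The values revealed in the list of all messages that a node exchanged with the prover. -/
def revealOf (n d t q : ℕ) [Fact q.Prime] (τ : List (Msg (proverBits n d t q))) (i : ℕ) :
    Reveal (ZMod q) t :=
  -- Phase `i` is revealed one prover message later, after the challenge at position `2 * i + 1`.
  (decode (τ.getD (2 * i + 2) fun _ => false) : ProverMsg n d t q).2

open Classical in
/-- The verification: each node sends the values revealed to it to its parent, the root queries the
oracle at the point given by its challenges, and each node tests what it knows. -/
def verification (n N d t q : ℕ) [NeZero n] [Fact q.Prime] :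
    DistAlg n N q (LocalInput n q × (Fin (N + 1) → Challenge (ZMod q) t) ×
      List (Msg (proverBits n d t q))) Bool where
  rounds := 1
  bits := nodeBits N t q
  Coin := Unit
  query x _ h := if x.1.id = 0 ∧ h.inbox = [] then some (point x.2.1) else none
  send x _ _ u := encode (A := NodeMsg N t q) _
    (if x.1.parent = some u then some (fun i => revealOf n d t q x.2.2 i) else none)
  output x _ h := decide (NodeCheck d x.1 x.2.1 (commitOf n d t q x.2.2) (revealOf n d t q x.2.2)
    (fun u => (h.inbox.getD 0 (fun _ => none) u).bind fun m => (decode m : NodeMsg N t q))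
    ((h.answers.getD 0 none).getD 0))

/-- The protocol: there are `N + 1` phases, in each of which the prover commits and every node sends
a challenge (only that of the root matters). The prover reveals its values for a phase in the next
message. -/
def protocol (n N d t q : ℕ) [NeZero n] [Fact q.Prime] : DIP n N q where
  -- Positions `0, …, 2 * N + 2`: commitment `i` is at `2 * i`, challenge `i` at `2 * i + 1`, and
  -- one last prover message reveals phase `N`.
  rounds := 2 * N + 3
  bits := proverBits n d t q
  Coin := Fin (N + 1) → Challenge (ZMod q) t
  nodeMsg _ c τ := encode _ (c (Fin.ofNat (N + 1) (τ.length / 2)))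
  verifier := verification n N d t q

theorem protocol_nodeMsg (x : LocalInput n q) (c : Fin (N + 1) → Challenge (ZMod q) t)
    {τ : List (Msg (protocol n N d t q).bits)} {k : ℕ} (hτ : τ.length = k) :
    (protocol n N d t q).nodeMsg x c τ
      = encode (proverBits n d t q) (c (Fin.ofNat (N + 1) (k / 2))) := by
  subst hτ; rfl

theorem verification_finalHist (P : Prover n (protocol n N d t q).bits)
    (I : SumcheckInstance n N d q) (ω : (protocol n N d t q).Coins P) (v : Fin n) :
    (protocol n N d t q).verifier.finalHist I.graph I.oracle
      ((protocol n N d t q).verifierInput P I ω) ω.2.1 v =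
      (⟨[if v = 0 then some (I.oracle (point (ω.1 v))) else none, none],
        [fun u => open Classical in if I.graph.Adj u v then
          some (encode (A := NodeMsg N t q) (nodeBits N t q) (if I.parent u = some v then
            some (fun i : Fin (N + 1) =>
              revealOf n d t q ((protocol n N d t q).nodeTranscript P I ω u) i)
            else none)) else none]⟩ : LocalHist n q (nodeBits N t q)) :=
  finalHist_of_rounds_eq_one (verification n N d t q) rfl (fun x => x.1.id)
    (fun x _ => point x.2.1) (fun _ _ _ => rfl) I.graph I.oracle _ (fun _ => rfl) _ _

theorem protocol_queryCount (P : Prover n (protocol n N d t q).bits)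
    (I : SumcheckInstance n N d q) (ω : (protocol n N d t q).Coins P) :
    (protocol n N d t q).queryCount P I ω = 1 :=
  queryCount_of_rounds_eq_one (verification n N d t q) rfl (fun x => x.1.id)
    (fun x _ => point x.2.1) (fun _ _ _ => rfl) I.graph I.oracle _ (fun _ => rfl) _

theorem bind_decode {adj child : Prop} [Decidable adj] [Decidable child] (h : child → adj)
    (r : Fin (N + 1) → Reveal (ZMod q) t) :
    ((if adj then some (encode (A := NodeMsg N t q) (nodeBits N t q)
      (if child then some r else none)) else none).bind fun m => (decode m : NodeMsg N t q))
      = if child then some r else none := by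
  by_cases hc : child
  · simp only [h hc, hc, if_true, Option.bind_some]
    exact decode_encode (card_nodeMsg_le N t q) _
  · by_cases ha : adj
    · simp only [ha, hc, if_true, if_false, Option.bind_some]
      exact decode_encode (card_nodeMsg_le N t q) _
    · simp [ha, hc]

theorem accepts_iff (P : Prover n (protocol n N d t q).bits) (I : SumcheckInstance n N d q)
    (ω : (protocol n N d t q).Coins P) :
    (protocol n N d t q).Accepts P I ω ↔ ∀ v, NodeCheck d (I.localInput v) (ω.1 v)
      (commitOf n d t q ((protocol n N d t q).nodeTranscript P I ω v))
      (revealOf n d t q ((protocol n N d t q).nodeTranscript P I ω v))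
      (fun u => if I.parent u = some v then some (fun i : Fin (N + 1) =>
              revealOf n d t q ((protocol n N d t q).nodeTranscript P I ω u) i)
            else none) (if v = 0 then I.oracle (point (ω.1 0)) else 0) := by
  classical
  refine forall_congr' fun v => ?_
  have hkids : (fun u => ((((protocol n N d t q).verifier.finalHist I.graph I.oracle
      ((protocol n N d t q).verifierInput P I ω) ω.2.1 v).inbox.getD 0 (fun _ => none) u).bind
        fun m => (decode m : NodeMsg N t q))) =
      (fun u => if I.parent u = some v then some (fun i : Fin (N + 1) =>
              revealOf n d t q ((protocol n N d t q).nodeTranscript P I ω u) i)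
            else none) := by
    rw [verification_finalHist]
    funext u
    exact bind_decode (I.parent_adj u v) _
  have hans : ((((protocol n N d t q).verifier.finalHist I.graph I.oracle
      ((protocol n N d t q).verifierInput P I ω) ω.2.1 v).answers.getD 0 none).getD 0)
      = if v = 0 then I.oracle (point (ω.1 0)) else 0 := by
    rw [verification_finalHist]
    by_cases hv : v = 0 <;> simp [hv]
  rw [← hkids, ← hans]
  exact decide_eq_true_iff

end Protocol

/-! ### Transcripts -/

section Transcript

variable {n N d q : ℕ} [NeZero n] (p : DIP n N q) (P : Prover n p.bits)
  (I : SumcheckInstance n N d q) (ω : p.Coins P)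

theorem length_transcript (k : ℕ) : (p.transcript P I ω k).length = k := by
  induction k with
  | zero => rfl
  | succ k ih => simp [DIP.transcript, ih]

theorem getD_transcript {k j : ℕ} (hj : j < k) (m : Fin n → Msg p.bits) :
    (p.transcript P I ω k).getD j m = if Odd (p.rounds - j) then P.msg ω.2.2 (p.transcript P I ω j)
      else fun v => p.nodeMsg (I.localInput v) (ω.1 v)
        ((p.transcript P I ω j).map fun m => m v) := by
  induction k with
  | zero => omega
  | succ k ih =>
    rw [DIP.transcript]
    rcases Nat.lt_succ_iff_lt_or_eq.1 hj with h | rfl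
    · rw [List.getD_append _ _ _ _ (by rwa [length_transcript]), ih h]
    · rw [List.getD_append_right _ _ _ _ (by rw [length_transcript])]
      simp [length_transcript]

theorem getD_nodeTranscript {j : ℕ} (hj : j < p.rounds) (v : Fin n) (m : Msg p.bits) :
    (p.nodeTranscript P I ω v).getD j m = (if Odd (p.rounds - j) then
      P.msg ω.2.2 (p.transcript P I ω j)
      else fun v => p.nodeMsg (I.localInput v) (ω.1 v)
        ((p.transcript P I ω j).map fun m => m v)) v := by
  rw [← getD_transcript p P I ω hj fun _ => m, DIP.nodeTranscript]
  rw [List.getD_map (p.transcript P I ω p.rounds) (fun _ => m) (fun f => f v)]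

end Transcript

/-! ### Soundness -/

section Soundness

/-- Allows the coins of all nodes but the root to be fixed. -/
theorem prob_le_of_fiber {ι X : Type} [Fintype ι] [DecidableEq ι] [Fintype X] [Nonempty X]
    (i : ι) (E : Set (ι → X)) {b : ℝ} (h : ∀ c, prob {x | Function.update c i x ∈ E} ≤ b) :
    prob E ≤ b := by
  classical
  rw [prob_resample i]
  have : (∑ x, prob {c | Function.update c i x ∈ E}) / Fintype.card X
      = (∑ c, prob {x | Function.update c i x ∈ E}) / Fintype.card (ι → X) := by
    simp only [prob_eq_sum, ← Finset.sum_div]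
    rw [Finset.sum_comm, div_right_comm]
    rfl
  rw [this]
  exact average_le_of_forall_le h

theorem update_apply_congr {ι κ X : Type} [DecidableEq ι] (x : ι → κ → X) (i : ι) {c c' : κ → X}
    {j : κ} (h : c j = c' j) (v : ι) :
    Function.update x i c v j = Function.update x i c' v j := by
  by_cases hv : v = i
  · subst hv; simpa using h
  · simp [hv]

theorem value_eq {K : Type} {N t : ℕ} (c : Fin (N + 1) → Challenge K t) (i : Fin (N + 1)) :
    value c i = (c i).1 := by
  unfold value
  rw [Fin.ofNat_val_eq_self]

variable {n N d t q : ℕ} [NeZero n] [Fact q.Prime]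

/-- Comparing challenges between parents and children makes them all equal to the root's coins.
Summed over all nodes, the local equations then telescope to the root's values. -/
theorem check_of_forall_nodeCheck (I : SumcheckInstance n N d q)
    (coin : Fin n → Fin (N + 1) → Challenge (ZMod q) t)
    (commit : Fin n → ℕ → Commit (ZMod q) (slots n d) t) (reveal : Fin n → ℕ → Reveal (ZMod q) t)
    (b : ZMod q)
    (h : ∀ v, NodeCheck d (I.localInput v) (coin v) (commit v) (reveal v)
      (fun u => if I.parent u = some v then some (fun i : Fin (N + 1) => reveal u i) else none)
      (if v = 0 then b else 0)) :
    (∀ i : Fin (N + 1), checkForm N i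
        (fun j => ∑ v, sharePoly d v (commit v j).left (commit v j).right) (value (coin 0))
        + ∑ v, (commit v i).mask = checkTarget N i I.target b) ∧
      ∀ (i : Fin (N + 1)) (l : Fin t),
        ∑ v, (commit v i).blind l + (coin 0 i).2 l * ∑ v, (commit v i).mask = 0 := by
  have hchal : ∀ (i : Fin (N + 1)) v, (reveal v i).chal = coin 0 i := by
    intro i v
    rw [← ((h 0).1 rfl i).1]
    refine eq_root_of_eq_parent I.reaches_root (x := fun v => (reveal v i).chal) ?_ v
    intro u v huv
    exact (h v).2.1 u _ (if_pos huv) i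
  have helim : ∀ (v : Fin n) (φ : (Fin (N + 1) → Reveal (ZMod q) t) → ZMod q),
      ∑ u, (if I.parent u = some v then
        some (fun i : Fin (N + 1) => reveal u i) else none).elim 0 φ
      = ∑ u, if I.parent u = some v then φ (fun i : Fin (N + 1) => reveal u i) else 0 := by
    intro v φ
    refine Finset.sum_congr rfl fun u _ => ?_
    split_ifs <;> rfl
  constructor
  · intro i
    have hroot := ((h 0).1 rfl i).2.1
    rw [if_pos rfl] at hroot
    change _ = checkTarget N i (I.localInput 0).target b
    rw [← hroot,
      ← sum_treeDiff I.parent_eq_none_iff (fun v => (reveal v i).sum), checkForm_sum,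
      ← Finset.sum_add_distrib]
    refine Finset.sum_congr rfl fun v _ => ?_
    have hv := ((h v).2.2 i).1
    rw [helim] at hv
    rw [treeDiff, hv, add_sub_cancel_right]
    congr 1
    refine checkForm_congr rfl rfl fun h0 => ?_
    have := hchal ⟨i - 1, by omega⟩ v
    simp only at this
    rw [this]
    exact value_eq _ ⟨i - 1, by omega⟩
  · intro i l
    rw [← ((h 0).1 rfl i).2.2 l,
      ← sum_treeDiff I.parent_eq_none_iff (fun v => (reveal v i).test l), Finset.mul_sum,
      ← Finset.sum_add_distrib]
    refine Finset.sum_congr rfl fun v _ => ?_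
    have hv := ((h v).2.2 i).2 l
    rw [helim, hchal i v] at hv
    rw [treeDiff, hv, add_sub_cancel_right]

/-- Causality: with all other coins fixed, the first `k` messages depend only on the root's
challenges sent among them. -/
theorem transcript_congr (P : Prover n (protocol n N d t q).bits) (I : SumcheckInstance n N d q)
    (ω : (protocol n N d t q).Coins P) (c c' : Fin (N + 1) → Challenge (ZMod q) t) {k : ℕ}
    (hk : k ≤ 2 * N + 3) (h : ∀ j : Fin (N + 1), 2 * (j : ℕ) + 1 < k → c j = c' j) :
    (protocol n N d t q).transcript P I (Function.update ω.1 0 c, ω.2) k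
      = (protocol n N d t q).transcript P I (Function.update ω.1 0 c', ω.2) k := by
  induction k with
  | zero => rfl
  | succ k ih =>
    have ih' := ih (by omega) fun j hj => h j (by omega)
    simp only [DIP.transcript]
    rw [ih']
    congr 2
    by_cases hodd : Odd ((protocol n N d t q).rounds - k)
    · rw [if_pos hodd, if_pos hodd]
    · rw [if_neg hodd, if_neg hodd]
      funext v
      have hlen : (((protocol n N d t q).transcript P I (Function.update ω.1 0 c', ω.2) k).map
          fun m => m v).length = k := by
        rw [List.length_map, length_transcript]
      refine (protocol_nodeMsg _ _ hlen).trans (Eq.trans ?_ (protocol_nodeMsg _ _ hlen).symm)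
      refine congrArg (encode _) (update_apply_congr ω.1 0 (h _ ?_) v)
      have hodd' : ¬ Odd (2 * N + 3 - k) := hodd
      rw [Nat.not_odd_iff] at hodd'
      have : k / 2 < N + 1 := by omega
      simp only [Fin.val_ofNat, Nat.mod_eq_of_lt this]
      omega

theorem commitOf_congr (P : Prover n (protocol n N d t q).bits) (I : SumcheckInstance n N d q)
    (ω : (protocol n N d t q).Coins P) (c c' : Fin (N + 1) → Challenge (ZMod q) t) {i : ℕ}
    (h : ∀ j : Fin (N + 1), (j : ℕ) < i → c j = c' j) (v : Fin n) :
    commitOf n d t q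
        ((protocol n N d t q).nodeTranscript P I (Function.update ω.1 0 c, ω.2) v) i
      = commitOf n d t q
        ((protocol n N d t q).nodeTranscript P I (Function.update ω.1 0 c', ω.2) v) i := by
  unfold commitOf
  congr 2
  by_cases hi : 2 * i < 2 * N + 3
  · have hodd : Odd ((protocol n N d t q).rounds - 2 * i) := by
      change Odd (2 * N + 3 - 2 * i)
      rw [Nat.odd_iff]; omega
    have hi' : 2 * i < (protocol n N d t q).rounds := hi
    refine (getD_nodeTranscript _ P I _ hi' v _).trans
      (Eq.trans ?_ (getD_nodeTranscript _ P I _ hi' v _).symm)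
    rw [if_pos hodd, if_pos hodd,
      transcript_congr P I ω c c' hi.le fun j hj => h j (by omega)]
  -- Beyond the end of the transcript both sides decode the same default message.
  · have hlen : ∀ ω, ((protocol n N d t q).nodeTranscript P I ω v).length ≤ 2 * i := by
      intro ω
      rw [DIP.nodeTranscript, List.length_map, length_transcript]
      exact not_lt.1 hi
    exact (List.getD_eq_default _ _ (hlen _)).trans (List.getD_eq_default _ _ (hlen _)).symm

theorem protocol_soundness (ht : 0 < t) (I : SumcheckInstance n N d q) (hI : ¬ I.Claim)
    (P : Prover n (protocol n N d t q).bits) :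
    (protocol n N d t q).acceptProb P I ≤ (N : ℝ) * d / q + 1 / t := by
  have hq : (2 : ℝ) ≤ q := by exact_mod_cast (Fact.out : q.Prime).two_le
  have hpow : 1 / (q : ℝ) ^ t ≤ 1 / t := by
    have h2 : (t : ℝ) ≤ 2 ^ t := by exact_mod_cast Nat.lt_two_pow_self.le
    have ht' : (0 : ℝ) < t := by exact_mod_cast ht
    gcongr
    exact h2.trans (by gcongr)
  refine le_trans ?_ (add_le_add_right hpow _)
  -- Fixing `y` makes the prover deterministic; afterwards only the root's challenges stay random.
  refine prob_prod_le _ fun y => ?_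
  refine prob_le_of_fiber (0 : Fin n) _ fun x => ?_
  let ω : (protocol n N d t q).Coins P := (x, y)
  let cm : (Fin (N + 1) → Challenge (ZMod q) t) → Fin n → ℕ → Commit (ZMod q) (slots n d) t :=
    fun c v => commitOf n d t q
      ((protocol n N d t q).nodeTranscript P I (Function.update ω.1 0 c, ω.2) v)
  let E : Set (Fin (N + 1) → Challenge (ZMod q) t) :=
    {c | (protocol n N d t q).Accepts P I (Function.update ω.1 0 c, ω.2)}
  let coin : (Fin (N + 1) → Challenge (ZMod q) t) → Fin n → Fin (N + 1) → Challenge (ZMod q) t :=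
    fun c => Function.update x 0 c
  have hcoin : ∀ c, coin c 0 = c := fun c => Function.update_self 0 c x
  have hE : ∀ c ∈ E, _ := fun c hc => check_of_forall_nodeCheck I (coin c) (cm c)
    (fun v => revealOf n d t q
      ((protocol n N d t q).nodeTranscript P I (Function.update ω.1 0 c, ω.2) v))
    (I.oracle (point (coin c 0))) (fun v => (accepts_iff P I _).1 hc v)
  have key := sumcheck_soundness (K := ZMod q) (t := t) (isPolyOfDegree_eval I.degreeOf_le)
    (a := I.target) hI E
    (fun i c => ∑ v, sharePoly d v (cm c v i).left (cm c v i).right)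
    (fun i c => ∑ v, (cm c v i).mask) (fun i c l => ∑ v, (cm c v i).blind l)
    (fun i c => natDegree_sum_le_of_forall_le _ _ fun v _ => natDegree_sharePoly_le _ _ _ _)
    (fun i c c' h => by
      have : ∀ v, cm c v i = cm c' v i := commitOf_congr P I ω c c' h
      simp only [this, and_self])
    (fun c hc i hi => by
      have := (hE c hc).1 ⟨i, Nat.lt_succ_of_le hi⟩
      rw [hcoin] at this
      exact this)
    (fun c hc i l => by
      have := (hE c hc).2 i l
      rw [hcoin] at this
      exact this)
  rw [ZMod.card] at key
  exact key

end Soundness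

/-! ### The honest prover -/

section Honest

/-- The coins of the honest prover: shares of the coefficients, sums over the subtrees in
the masked checks, and sums over the subtrees of the blinding values. -/
@[ext] structure ProverCoin (n N d t q : ℕ) where
  share : Fin (N + 1) → Fin n → Fin (slots n d) → ZMod q
  sum : Fin (N + 1) → Fin n → ZMod q
  blind : Fin (N + 1) → Fin t → Fin n → ZMod q

def ProverCoin.equivProd (n N d t q : ℕ) : ProverCoin n N d t q ≃
    (Fin (N + 1) → Fin n → Fin (slots n d) → ZMod q) ×
      ((Fin (N + 1) → Fin n → ZMod q) × (Fin (N + 1) → Fin t → Fin n → ZMod q)) where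
  toFun c := (c.share, c.sum, c.blind)
  invFun p := ⟨p.1, p.2.1, p.2.2⟩
  left_inv _ := rfl
  right_inv _ := rfl

instance (n N d t q : ℕ) [Fact q.Prime] : Fintype (ProverCoin n N d t q) :=
  @Fintype.ofEquiv _ _ (@instFintypeProd _ _ inferInstance inferInstance)
    (ProverCoin.equivProd n N d t q).symm

instance (n N d t q : ℕ) : Nonempty (ProverCoin n N d t q) := ⟨⟨0, 0, 0⟩⟩

variable {n N d t q : ℕ} [NeZero n] [Fact q.Prime]

section Defs

variable (I : SumcheckInstance n N d q) (κ : ProverCoin n N d t q)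
  (e : Fin (N + 1) → Challenge (ZMod q) t)

def honestLeft (i : ℕ) (v : Fin n) (k : Fin (slots n d)) : ZMod q :=
  κ.share (Fin.ofNat (N + 1) i) v k

/-- The complementary share: node `v - 1` keeps the random summand and node `v` gets the difference.
-/
def honestRight (i : ℕ) (v : Fin n) (k : Fin (slots n d)) : ZMod q :=
  (roundPoly d I.oracle (point e) i).coeff ((v - 1 : Fin n) + n * k)
    - κ.share (Fin.ofNat (N + 1) i) (v - 1) k

def honestForm (i : ℕ) (v : Fin n) : ZMod q :=
  checkForm N i (fun j => sharePoly d v (honestLeft κ j v) (honestRight I κ e j v)) (value e)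

/-- Subtree sums are drawn freely off the root and prescribed at it; `honestCommit` then solves for
the masks, and likewise for the blinding values. -/
def honestSum (i : ℕ) (v : Fin n) : ZMod q :=
  if v = 0 then checkTarget N i I.target (I.oracle (point e)) else κ.sum (Fin.ofNat (N + 1) i) v

def honestBlindSum (i : ℕ) (l : Fin t) (v : Fin n) : ZMod q :=
  if v = 0 then 0 else κ.blind (Fin.ofNat (N + 1) i) l v

/-- The sums of the masks over the subtrees. -/
def honestMaskSum (i : ℕ) (v : Fin n) : ZMod q :=
  honestSum I κ e i v - treeSum I.parent (honestForm I κ e i) v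

def honestCommit (i : ℕ) (v : Fin n) : Commit (ZMod q) (slots n d) t where
  left := honestLeft κ i v
  right := honestRight I κ e i v
  mask := treeDiff I.parent (honestSum I κ e i) v - honestForm I κ e i v
  blind l := treeDiff I.parent (honestBlindSum κ i l) v

def honestReveal (i : ℕ) (v : Fin n) : Reveal (ZMod q) t where
  chal := e (Fin.ofNat (N + 1) i)
  sum := honestSum I κ e i v
  test l := honestBlindSum κ i l v + (e (Fin.ofNat (N + 1) i)).2 l * honestMaskSum I κ e i v

end Defs

/-- The message of the prover in phase `i`, made from commitments and revealed values. -/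
def phaseMsg (N : ℕ) {n d t q : ℕ} [Fact q.Prime] (commit : ℕ → Commit (ZMod q) (slots n d) t)
    (reveal : ℕ → Reveal (ZMod q) t) (i : ℕ) : ProverMsg n d t q :=
  (if i ≤ N then commit i else default, if i = 0 then default else reveal (i - 1))

theorem phaseMsg_congr {n N d t q : ℕ} [Fact q.Prime]
    {commit commit' : ℕ → Commit (ZMod q) (slots n d) t}
    {reveal reveal' : ℕ → Reveal (ZMod q) t} {i : ℕ} (hc : i ≤ N → commit i = commit' i)
    (hr : i ≠ 0 → reveal (i - 1) = reveal' (i - 1)) :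
    phaseMsg N commit reveal i = phaseMsg N commit' reveal' i := by
  unfold phaseMsg
  congr 1
  · split_ifs with h
    · exact hc h
    · rfl
  · split_ifs with h
    · rfl
    · exact hr h

/-- The challenges of the root that occur in a list of messages. -/
def challengeOf {b : ℕ} (τ : List (Fin n → Msg b)) (j : Fin (N + 1)) : Challenge (ZMod q) t :=
  decode (τ.getD (2 * j + 1) (fun _ _ => false) 0)

/-- Challenges not yet sent are decoded from a default message; the congruence lemmas show that they
have no influence. -/
def honestProver (t : ℕ) (I : SumcheckInstance n N d q) :
    Prover n (protocol n N d t q).bits where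
  Coin := ProverCoin n N d t q
  msg κ τ v := encode (proverBits n d t q) (phaseMsg N
    (fun i => honestCommit I κ (challengeOf τ) i v) (fun i => honestReveal I κ (challengeOf τ) i v)
    (τ.length / 2))

theorem ofNat_eq {i : ℕ} (hi : i < N + 1) : Fin.ofNat (N + 1) i = ⟨i, hi⟩ := by
  ext; simp [Nat.mod_eq_of_lt hi]

/-! ### Causality of the honest prover: each message depends on past challenges only -/

section Congr

variable (I : SumcheckInstance n N d q) (κ : ProverCoin n N d t q)
  {e e' : Fin (N + 1) → Challenge (ZMod q) t}

theorem honestRight_congr {i : ℕ} (h : ∀ j : Fin (N + 1), (j : ℕ) < i → e j = e' j) (v : Fin n) :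
    honestRight I κ e i v = honestRight I κ e' i v := by
  funext k
  unfold honestRight
  rw [roundPoly_congr d I.oracle (r := point e) (r' := point e') fun j hj => ?_]
  unfold point
  rw [h j.castSucc (by simpa using hj)]

theorem honestForm_congr {i : ℕ} (hi : i ≤ N) (h : ∀ j : Fin (N + 1), (j : ℕ) < i → e j = e' j)
    (v : Fin n) : honestForm I κ e i v = honestForm I κ e' i v := by
  refine checkForm_congr ?_ ?_ fun h0 => ?_
  · simp only [honestRight_congr I κ h]
  · rw [honestRight_congr I κ fun j hj => h j (by omega)]
  · unfold value
    rw [ofNat_eq (by omega : i - 1 < N + 1), h _ (by simp only; omega)]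

/-- The oracle value enters only for `i = N`, and the first `N` challenges already determine the
query point. -/
theorem honestSum_congr {i : ℕ} (h : ∀ j : Fin (N + 1), (j : ℕ) < i → e j = e' j) (v : Fin n) :
    honestSum I κ e i v = honestSum I κ e' i v := by
  unfold honestSum checkTarget
  split_ifs with hv h0 hN hN <;> try rfl
  all_goals
    subst hN
    have : point e = point e' := by
      funext j
      unfold point
      rw [h j.castSucc (by simp)]
    rw [this]

theorem honestCommit_congr {i : ℕ} (hi : i ≤ N) (h : ∀ j : Fin (N + 1), (j : ℕ) < i → e j = e' j)
    (v : Fin n) : honestCommit I κ e i v = honestCommit I κ e' i v := by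
  unfold honestCommit
  rw [honestRight_congr I κ h, honestForm_congr I κ hi h]
  have : honestSum I κ e i = honestSum I κ e' i := funext fun v => honestSum_congr I κ h v
  rw [this]

theorem honestReveal_congr {i : ℕ} (hi : i ≤ N)
    (h : ∀ j : Fin (N + 1), (j : ℕ) < i + 1 → e j = e' j)
    (v : Fin n) : honestReveal I κ e i v = honestReveal I κ e' i v := by
  have h' : ∀ j : Fin (N + 1), (j : ℕ) < i → e j = e' j := fun j hj => h j (by omega)
  have hform : honestForm I κ e i = honestForm I κ e' i :=
    funext fun v => honestForm_congr I κ hi h' v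
  unfold honestReveal honestMaskSum
  rw [ofNat_eq (by omega : i < N + 1), h _ (by simp), honestSum_congr I κ h', hform]

end Congr

/-- The messages exchanged between a node with coins `c` and the prover. -/
def transcriptOf {n N d t q : ℕ} [Fact q.Prime] (c : Fin (N + 1) → Challenge (ZMod q) t)
    (msg : ℕ → ProverMsg n d t q) : List (Msg (proverBits n d t q)) :=
  (List.range (2 * N + 3)).map fun j =>
    if Even j then encode _ (msg (j / 2)) else encode _ (c (Fin.ofNat (N + 1) (j / 2)))

theorem length_transcriptOf {n N d t q : ℕ} [Fact q.Prime]
    (c : Fin (N + 1) → Challenge (ZMod q) t) (msg : ℕ → ProverMsg n d t q) :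
    (transcriptOf c msg).length = 2 * N + 3 := by
  simp [transcriptOf]

theorem getD_transcriptOf {n N d t q : ℕ} [Fact q.Prime]
    (c : Fin (N + 1) → Challenge (ZMod q) t)
    (msg : ℕ → ProverMsg n d t q) {j : ℕ} (hj : j < 2 * N + 3) (m : Msg (proverBits n d t q)) :
    (transcriptOf c msg).getD j m = if Even j then encode _ (msg (j / 2))
      else encode _ (c (Fin.ofNat (N + 1) (j / 2))) := by
  unfold transcriptOf
  rw [List.getD_eq_getElem _ _ (by simpa using hj)]
  simp

theorem commitOf_transcriptOf {n N d t q : ℕ} [Fact q.Prime]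
    (c : Fin (N + 1) → Challenge (ZMod q) t)
    (msg : ℕ → ProverMsg n d t q) {i : ℕ} (hi : i ≤ N) :
    commitOf n d t q (transcriptOf c msg) i = (msg i).1 := by
  unfold commitOf
  rw [getD_transcriptOf c msg (by omega), if_pos (by simp), decode_encode (card_proverMsg_le _ _ _ _)]
  simp

theorem revealOf_transcriptOf {n N d t q : ℕ} [Fact q.Prime]
    (c : Fin (N + 1) → Challenge (ZMod q) t)
    (msg : ℕ → ProverMsg n d t q) {i : ℕ} (hi : i ≤ N) :
    revealOf n d t q (transcriptOf c msg) i = (msg (i + 1)).2 := by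
  unfold revealOf
  rw [getD_transcriptOf c msg (by omega), if_pos (by simp [parity_simps]),
    decode_encode (card_proverMsg_le _ _ _ _), show (2 * i + 2) / 2 = i + 1 by omega]

theorem transcriptOf_congr {n N d t q : ℕ} [Fact q.Prime]
    (c : Fin (N + 1) → Challenge (ZMod q) t)
    {msg msg' : ℕ → ProverMsg n d t q} (h : ∀ i ≤ N + 1, msg i = msg' i) :
    transcriptOf c msg = transcriptOf c msg' := by
  refine List.map_congr_left fun j hj => ?_
  rw [List.mem_range] at hj
  rw [h (j / 2) (by omega)]

theorem list_eq_of_getD {A : Type} {l l' : List A} (a : A) (hlen : l.length = l'.length)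
    (h : ∀ j < l.length, l.getD j a = l'.getD j a) : l = l' := by
  refine List.ext_getElem hlen fun j hj hj' => ?_
  have := h j hj
  rwa [List.getD_eq_getElem _ _ hj, List.getD_eq_getElem _ _ hj'] at this

theorem honest_nodeTranscript (I : SumcheckInstance n N d q)
    (c : Fin n → Fin (N + 1) → Challenge (ZMod q) t) (y : Fin n → Unit)
    (κ : ProverCoin n N d t q) (v : Fin n) :
    (protocol n N d t q).nodeTranscript (honestProver t I) I (c, y, κ) v
      = transcriptOf (c v) (phaseMsg N (fun i => honestCommit I κ (c 0) i v)
          (fun i => honestReveal I κ (c 0) i v)) := by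
  have hlen : ((protocol n N d t q).nodeTranscript (honestProver t I) I (c, y, κ) v).length
      = 2 * N + 3 := by
    rw [DIP.nodeTranscript, List.length_map, length_transcript]; rfl
  refine list_eq_of_getD (fun _ => false) (hlen.trans (length_transcriptOf _ _).symm) fun j hj => ?_
  rw [hlen] at hj
  refine Eq.trans ?_ (getD_transcriptOf _ _ hj _).symm
  have hj'' : j < (protocol n N d t q).rounds := hj
  refine (getD_nodeTranscript _ _ I _ hj'' v _).trans ?_
  have hpar : Odd ((protocol n N d t q).rounds - j) ↔ Even j := by
    change Odd (2 * N + 3 - j) ↔ Even j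
    rw [Nat.odd_iff, Nat.even_iff]; omega
  by_cases he : Even j
  · rw [if_pos (hpar.2 he), if_pos he]
    have hlen' := length_transcript (protocol n N d t q) (honestProver t I) I (c, y, κ) j
    have hchal : ∀ i : Fin (N + 1), (i : ℕ) < j / 2 →
        challengeOf (N := N) (q := q) (t := t)
          ((protocol n N d t q).transcript (honestProver t I) I (c, y, κ) j) i = c 0 i := by
      intro i hi
      unfold challengeOf
      have hij : 2 * (i : ℕ) + 1 < j := by omega
      have hodd : ¬ Odd ((protocol n N d t q).rounds - (2 * (i : ℕ) + 1)) := by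
        change ¬ Odd (2 * N + 3 - (2 * (i : ℕ) + 1))
        rw [Nat.not_odd_iff]; omega
      have hget := getD_transcript (protocol n N d t q) (honestProver t I) I (c, y, κ) hij
        (fun _ _ => false)
      rw [if_neg hodd] at hget
      refine (congrArg (fun f => decode (A := Challenge (ZMod q) t) (f 0)) hget).trans ?_
      refine (congrArg (decode (A := Challenge (ZMod q) t)) (protocol_nodeMsg _ _ (k := 2 * (i : ℕ) + 1)
        (by rw [List.length_map, length_transcript]))).trans ?_
      refine (decode_encode (card_challenge_le n d t q) _).trans (congrArg (c 0) ?_)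
      rw [ofNat_eq (by omega)]
      ext; simp only; omega
    refine congrArg (encode _) ?_
    rw [hlen']
    refine phaseMsg_congr (fun hi => ?_) fun hi => ?_
    · exact honestCommit_congr I _ hi hchal v
    · exact honestReveal_congr I _ (by omega) (fun i hi' => hchal i (by omega)) v
  · rw [if_neg (mt hpar.1 he), if_neg he]
    exact protocol_nodeMsg _ _ (by rw [List.length_map, length_transcript])

/-- Shifting the right shares by one node pairs each of them with its left share, which leaves the
coefficients. The indices `v + n * k` run once through a range that contains `0, …, d`. -/
theorem sum_sharePoly (I : SumcheckInstance n N d q) (κ : ProverCoin n N d t q)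
    (e : Fin (N + 1) → Challenge (ZMod q) t) (i : ℕ) :
    ∑ v, sharePoly d v (honestLeft κ i v) (honestRight I κ e i v)
      = roundPoly d I.oracle (point e) i := by
  set p := roundPoly d I.oracle (point e) i with hp
  have hdeg : p.natDegree ≤ d := natDegree_roundPoly_le _ _ _ _
  have hshift : ∑ v : Fin n, ∑ k, C (honestRight I κ e i v k) *
        cutMonomial q d ((v - 1 : Fin n) + n * k)
      = ∑ v : Fin n, ∑ k : Fin (slots n d), C (p.coeff (v + n * k) - κ.share (Fin.ofNat (N + 1) i) v k)
        * cutMonomial q d (v + n * k) :=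
    Fintype.sum_equiv (Equiv.subRight (1 : Fin n)) _ _ fun v => rfl
  have hadd : ∑ v, sharePoly d v (honestLeft κ i v) (honestRight I κ e i v)
      = ∑ v : Fin n, ∑ k : Fin (slots n d), C (p.coeff (v + n * k)) * cutMonomial q d (v + n * k) := by
    simp only [sharePoly, Finset.sum_add_distrib]
    rw [hshift, ← Finset.sum_add_distrib]
    refine Finset.sum_congr rfl fun v _ => ?_
    rw [← Finset.sum_add_distrib]
    refine Finset.sum_congr rfl fun k _ => ?_
    rw [← add_mul, ← C_add]
    simp [honestLeft]
  have hlt : d < slots n d * n := by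
    rw [mul_comm]; exact Nat.lt_mul_div_succ d (Nat.pos_of_neZero n)
  rw [hadd, Finset.sum_comm, ← Fintype.sum_prod_type'
      (f := fun (k : Fin (slots n d)) (v : Fin n) =>
        C (p.coeff (v + n * k)) * cutMonomial q d (v + n * k)),
    Fintype.sum_equiv finProdFinEquiv
      (fun x : Fin (slots n d) × Fin n =>
        C (p.coeff (x.2 + n * x.1)) * cutMonomial q d (x.2 + n * x.1))
      (fun j : Fin (slots n d * n) => C (p.coeff j) * cutMonomial q d j) (fun x => rfl),
    Fin.sum_univ_eq_sum_range (fun j => C (p.coeff j) * cutMonomial q d j)]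
  conv_rhs => rw [as_sum_range' p (slots n d * n) (hdeg.trans_lt hlt)]
  refine Finset.sum_congr rfl fun j _ => ?_
  unfold cutMonomial
  split_ifs with hj
  · rw [C_mul_X_pow_eq_monomial]
  · rw [coeff_eq_zero_of_natDegree_lt (by omega)]; simp

/-- Here the truth of the claim enters: the local forms add up to the target, which is also the
prescribed sum at the root. -/
theorem honestMaskSum_zero (I : SumcheckInstance n N d q) (hI : I.Claim)
    (κ : ProverCoin n N d t q) (e : Fin (N + 1) → Challenge (ZMod q) t) {i : ℕ} (hi : i ≤ N) :
    honestMaskSum I κ e i 0 = 0 := by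
  unfold honestMaskSum
  rw [treeSum_root I.parent_eq_none_iff I.reaches_root]
  unfold honestForm
  rw [← checkForm_sum]
  simp only [sum_sharePoly]
  have h := checkForm_roundPoly (g := I.oracle) (isPolyOfDegree_eval I.degreeOf_le) hI (point e)
    (value_fin e) hi
  rw [h]
  simp [honestSum]

/-- `treeDiff` is linear and inverts `treeSum`, so applied to the revealed tests it gives back
blinding value plus coefficient times mask. -/
theorem honest_test_eq (I : SumcheckInstance n N d q) (κ : ProverCoin n N d t q)
    (e : Fin (N + 1) → Challenge (ZMod q) t) (i : ℕ) (v : Fin n) (l : Fin t) :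
    (honestReveal I κ e i v).test l = (honestCommit I κ e i v).blind l
      + (e (Fin.ofNat (N + 1) i)).2 l * (honestCommit I κ e i v).mask
      + ∑ u, if I.parent u = some v then (honestReveal I κ e i u).test l else 0 := by
  have h : treeDiff I.parent (fun u => (honestReveal I κ e i u).test l) v
      = (honestCommit I κ e i v).blind l
      + (e (Fin.ofNat (N + 1) i)).2 l * (honestCommit I κ e i v).mask := by
    simp only [honestReveal, honestCommit]
    rw [treeDiff_add, treeDiff_mul]
    unfold honestMaskSum
    rw [treeDiff_sub, treeDiff_treeSum I.parent_eq_none_iff I.reaches_root]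
  rw [← h, treeDiff]
  ring

theorem honest_sum_eq (I : SumcheckInstance n N d q) (κ : ProverCoin n N d t q)
    (e : Fin (N + 1) → Challenge (ZMod q) t) (i : ℕ) (v : Fin n) :
    honestSum I κ e i v = honestForm I κ e i v + (honestCommit I κ e i v).mask
      + ∑ u, if I.parent u = some v then honestSum I κ e i u else 0 := by
  simp only [honestCommit, treeDiff]
  ring

theorem honest_nodeCheck (I : SumcheckInstance n N d q) (hI : I.Claim)
    (c : Fin n → Fin (N + 1) → Challenge (ZMod q) t) (κ : ProverCoin n N d t q)
    (commit : Fin n → ℕ → Commit (ZMod q) (slots n d) t)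
    (reveal : Fin n → ℕ → Reveal (ZMod q) t)
    (hC : ∀ v, ∀ i ≤ N, commit v i = honestCommit I κ (c 0) i v)
    (hR : ∀ v, ∀ i ≤ N, reveal v i = honestReveal I κ (c 0) i v) (v : Fin n) :
    NodeCheck d (I.localInput v) (c v) (commit v) (reveal v)
      (fun u => if I.parent u = some v then some (fun i : Fin (N + 1) => reveal u i) else none)
      (if v = 0 then I.oracle (point (c 0)) else 0) := by
  have hle : ∀ i : Fin (N + 1), (i : ℕ) ≤ N := fun i => Nat.lt_succ_iff.1 i.2
  have hkid : ∀ (i : Fin (N + 1)) (φ : Reveal (ZMod q) t → ZMod q),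
      ∑ u, (if I.parent u = some v then some (fun i : Fin (N + 1) => reveal u i) else none).elim 0
        (fun r => φ (r i))
      = ∑ u, if I.parent u = some v then φ (honestReveal I κ (c 0) i u) else 0 := by
    intro i φ
    refine Finset.sum_congr rfl fun u _ => ?_
    split_ifs
    · exact congrArg φ (hR u i (hle i))
    · rfl
  refine ⟨?_, ?_, fun i => ⟨?_, fun l => ?_⟩⟩
  · rintro hv i
    have hv' : v = 0 := hv
    subst hv'
    rw [hR 0 i (hle i)]
    refine ⟨?_, ?_, fun l => ?_⟩
    · simp only [honestReveal, Fin.ofNat_val_eq_self]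
    · simp only [honestReveal, honestSum, if_true]; rfl
    · simp only [honestReveal]
      rw [honestMaskSum_zero I hI _ _ (hle i)]
      simp [honestBlindSum]
  · intro u r hr i
    simp only at hr
    split_ifs at hr
    cases hr
    simp only
    rw [hR u i (hle i), hR v i (hle i)]
    rfl
  · rw [hkid i (fun r => r.sum), hR v i (hle i), hC v i (hle i)]
    refine (honest_sum_eq I κ (c 0) i v).trans ?_
    congr 2
    unfold honestForm
    refine checkForm_congr ?_ ?_ fun h0 => ?_
    · rw [hC v i (hle i)]; rfl
    · rw [hC v (i - 1) (by omega)]; rfl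
    · rw [hR v (i - 1) (by omega)]; rfl
  · rw [hkid i (fun r => r.test l), hR v i (hle i), hC v i (hle i)]
    exact honest_test_eq I κ (c 0) i v l

theorem honest_accepts (I : SumcheckInstance n N d q) (hI : I.Claim)
    (ω : (protocol n N d t q).Coins (honestProver t I)) :
    (protocol n N d t q).Accepts (honestProver t I) I ω := by
  rw [accepts_iff]
  obtain ⟨c, y, κ⟩ := ω
  refine honest_nodeCheck I hI c κ _ _ (fun v i hi => ?_) fun v i hi => ?_
  · have h := commitOf_transcriptOf (c v) (phaseMsg N (fun i => honestCommit I κ (c 0) i v)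
      (fun i => honestReveal I κ (c 0) i v)) hi
    rw [← honest_nodeTranscript I c y κ v] at h
    simpa [phaseMsg, hi] using h
  · have h := revealOf_transcriptOf (c v) (phaseMsg N (fun i => honestCommit I κ (c 0) i v)
      (fun i => honestReveal I κ (c 0) i v)) hi
    rw [← honest_nodeTranscript I c y κ v] at h
    simpa [phaseMsg] using h

theorem honest_acceptProb (I : SumcheckInstance n N d q) (hI : I.Claim) :
    (protocol n N d t q).acceptProb (honestProver t I) I = 1 := by
  unfold DIP.acceptProb
  rw [show {ω | (protocol n N d t q).Accepts (honestProver t I) I ω} = Set.univ from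
    Set.eq_univ_of_forall (honest_accepts I hI), prob_univ]

end Honest

/-! ### The simulator -/

section Simulation

/-- The coins of all nodes and of the honest prover. -/
abbrev AllCoins (n N d t q : ℕ) : Type :=
  (Fin n → Fin (N + 1) → Challenge (ZMod q) t) × (Fin n → Unit) × ProverCoin n N d t q

variable {n N d t q : ℕ} [NeZero n] [Fact q.Prime]

section Render

variable (x : LocalInput n q) (kid : Fin n → Bool) (ans : ZMod q) (ω : AllCoins n N d t q)

def simSum (i : ℕ) : ZMod q :=
  if x.id = 0 then checkTarget N i x.target ans else ω.2.2.sum (Fin.ofNat (N + 1) i) x.id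

def simTest (i : ℕ) (l : Fin t) : ZMod q :=
  if x.id = 0 then 0 else ω.2.2.blind (Fin.ofNat (N + 1) i) l x.id

def simMask (i : ℕ) : ZMod q :=
  simSum x ans ω i
    - checkForm N i (fun j => sharePoly d x.id (ω.2.2.share (Fin.ofNat (N + 1) j) x.id)
        (ω.2.2.share (Fin.ofNat (N + 1) j) (x.id - 1))) (value (ω.1 0))
    - ∑ u, if kid u then ω.2.2.sum (Fin.ofNat (N + 1) i) u else 0

def simCommit (i : ℕ) : Commit (ZMod q) (slots n d) t where
  left := ω.2.2.share (Fin.ofNat (N + 1) i) x.id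
  right := ω.2.2.share (Fin.ofNat (N + 1) i) (x.id - 1)
  mask := simMask x kid ans ω i
  blind l := simTest x ω i l - (ω.1 0 (Fin.ofNat (N + 1) i)).2 l * simMask x kid ans ω i
    - ∑ u, if kid u then ω.2.2.blind (Fin.ofNat (N + 1) i) l u else 0

def simReveal (i : ℕ) : Reveal (ZMod q) t where
  chal := ω.1 0 (Fin.ofNat (N + 1) i)
  sum := simSum x ans ω i
  test := simTest x ω i

def simKidReveal (u : Fin n) (i : Fin (N + 1)) : Reveal (ZMod q) t where
  chal := ω.1 0 i
  sum := ω.2.2.sum i u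
  test l := ω.2.2.blind i l u

open Classical in
/-- The view of a node with local input `x`, children `kid` and oracle answer `ans` for which all
shares, sums over subtrees and blinded tests are random, and everything else is computed from them
in the only way that lets the node accept. -/
def simulatedView : NodeView (protocol n N d t q) where
  coin := ω.1 x.id
  proverMsgs := transcriptOf (ω.1 x.id) (phaseMsg N (simCommit x kid ans ω) (simReveal x ans ω))
  verifierCoin := ()
  received := ⟨[if x.id = 0 then some ans else none, none],
    [fun u => if u ∈ x.nbrs then some (encode (A := NodeMsg N t q) (nodeBits N t q)
      (if kid u then some (simKidReveal ω u) else none)) else none]⟩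

end Render

/-- The simulator: in one round every node learns which of its neighbours are its children, the root
queries the oracle at a random point, and then every node samples its view. -/
def simulator (n N d t q : ℕ) [NeZero n] [Fact q.Prime] : Simulator (protocol n N d t q) where
  rounds := 1
  bits := 1
  Coin := AllCoins n N d t q
  query x ω h := if x.id = 0 ∧ h.inbox = [] then some (point (ω.1 0)) else none
  send x _ _ u := fun _ => decide (x.parent = some u)
  output x ω h := simulatedView x
    (fun u => (h.inbox.getD 0 (fun _ => none) u).elim false fun m => m 0)
    ((h.answers.getD 0 none).getD 0) ω

theorem simulator_queryCount (I : SumcheckInstance n N d q)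
    (c : Fin n → (simulator n N d t q).Coin) :
    DIP.simQueryCount (simulator n N d t q) I c = 1 :=
  queryCount_of_rounds_eq_one (simulator n N d t q) rfl (fun x => x.id)
    (fun _ ω => point (ω.1 0)) (fun _ _ _ => rfl) I.graph I.oracle _ (fun _ => rfl) _

/-- The view at `v` in terms of all coins. -/
def idealView (I : SumcheckInstance n N d q) (v : Fin n) (ω : AllCoins n N d t q) :
    NodeView (protocol n N d t q) :=
  simulatedView (I.localInput v) (fun u => decide (I.parent u = some v))
    (if v = 0 then I.oracle (point (ω.1 0)) else 0) ω

theorem simView_eq (I : SumcheckInstance n N d q) (v : Fin n)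
    (c : Fin n → AllCoins n N d t q) :
    DIP.simView (simulator n N d t q) I v c = idealView I v (c v) := by
  classical
  have h := finalHist_of_rounds_eq_one (simulator n N d t q) rfl (fun x => x.id)
    (fun _ ω => point (ω.1 0)) (fun _ _ _ => rfl) I.graph I.oracle I.localInput (fun _ => rfl) c v
  unfold DIP.simView DistAlg.out
  rw [h]
  unfold idealView
  change simulatedView _ _ _ _ = _
  congr 1
  · funext u
    by_cases hp : I.parent u = some v
    · have ha : I.graph.Adj u v := I.parent_adj u v hp
      simp [ha, hp, simulator, SumcheckInstance.localInput]
    · by_cases ha : I.graph.Adj u v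
      · simp [ha, hp, simulator, SumcheckInstance.localInput]
      · simp [ha, hp, simulator]
  · by_cases hv : v = 0 <;> simp [hv]

/-- The change of coins after which the view at `v` is computed as by the simulator. -/
def recoin (I : SumcheckInstance n N d q) (v : Fin n) (ω : AllCoins n N d t q) :
    AllCoins n N d t q :=
  (ω.1, ω.2.1,
    -- At the predecessor the share is exchanged for the complementary one, which is what `v` sees.
    { share := fun i u k => if u = v - 1 then
        (roundPoly d I.oracle (point (ω.1 0)) i).coeff (u + n * k) - ω.2.2.share i u k
        else ω.2.2.share i u k
      sum := ω.2.2.sum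
      -- The shifted blinding sums are the revealed tests off the root.
      blind := fun i l u => ω.2.2.blind i l u
        + (ω.1 0 i).2 l * honestMaskSum I ω.2.2 (ω.1 0) i u })

/-- The map is triangular: challenges and sums are unchanged and determine how the shares are
reflected. All of these determine the mask sums, hence the shift of the blinding values. -/
theorem recoin_injective (I : SumcheckInstance n N d q) (v : Fin n) :
    Function.Injective (recoin (t := t) I v) := by
  rintro ⟨c, y, κ⟩ ⟨c', y', κ'⟩ h
  obtain rfl : c = c' := congrArg (fun ω => ω.1) h
  obtain rfl : y = y' := Subsingleton.elim _ _
  have hsum : κ.sum = κ'.sum := congrArg (fun ω => ω.2.2.sum) h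
  have hshare : κ.share = κ'.share := by
    funext i u k
    have := congrArg (fun ω => ω.2.2.share i u k) h
    simp only [recoin] at this
    split_ifs at this
    · simpa using this
    · exact this
  have hmask : ∀ i u, honestMaskSum I κ (c 0) i u = honestMaskSum I κ' (c 0) i u := by
    intro i u
    unfold honestMaskSum honestSum honestForm honestRight honestLeft
    rw [hsum, hshare]
  have hblind : κ.blind = κ'.blind := by
    funext i l u
    have := congrArg (fun ω => ω.2.2.blind i l u) h
    simp only [recoin, hmask] at this
    exact add_right_cancel this
  rw [ProverCoin.ext hshare hsum hblind]

theorem recoin_bijective (I : SumcheckInstance n N d q) (v : Fin n) :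
    Function.Bijective (recoin (t := t) I v) :=
  Finite.injective_iff_bijective.1 (recoin_injective I v)

theorem ne_zero_of_parent {n N d q : ℕ} [NeZero n] (I : SumcheckInstance n N d q) {u v : Fin n}
    (h : I.parent u = some v) : u ≠ 0 := by
  intro hu
  rw [(I.parent_eq_none_iff u).2 hu] at h
  cases h

/-! ### Agreement of the real and the simulated view after the change of coins -/

section Match

variable (I : SumcheckInstance n N d q) (v : Fin n)
  (c : Fin n → Fin (N + 1) → Challenge (ZMod q) t) (y : Fin n → Unit) (κ : ProverCoin n N d t q)

/-- The point where `n ≥ 2` is needed: only then is `v` different from its predecessor, so that its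
own share is left unchanged. -/
theorem recoin_share_self (hn : 2 ≤ n) (i : Fin (N + 1)) :
    (recoin I v (c, y, κ)).2.2.share i v = honestLeft κ i v := by
  funext k
  have hv : v ≠ v - 1 := by
    intro h
    have h1 : (1 : Fin n) = 0 := by simpa using h.symm
    rw [Fin.one_eq_zero_iff] at h1
    omega
  simp [recoin, hv, honestLeft]

theorem recoin_share_pred (i : Fin (N + 1)) :
    (recoin I v (c, y, κ)).2.2.share i (v - 1) = honestRight I κ (c 0) i v := by
  funext k
  simp [recoin, honestRight]

theorem recoin_simKidReveal {u : Fin n} (hu : u ≠ 0) (i : Fin (N + 1)) :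
    simKidReveal (recoin I v (c, y, κ)) u i = honestReveal I κ (c 0) i u := by
  unfold simKidReveal honestReveal
  congr 1
  · simp [recoin]
  · simp [recoin, honestSum, hu]
  · simp [recoin, honestBlindSum, hu]

theorem recoin_simReveal (hI : I.Claim) (i : Fin (N + 1)) :
    simReveal (I.localInput v) (if v = 0 then I.oracle (point (c 0)) else 0)
      (recoin I v (c, y, κ)) i = honestReveal I κ (c 0) i v := by
  by_cases hv : v = 0
  · subst hv
    unfold simReveal honestReveal
    rw [honestMaskSum_zero I hI κ (c 0) (Nat.lt_succ_iff.1 i.2)]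
    congr 1
    funext l
    simp [simTest, SumcheckInstance.localInput, honestBlindSum]
  · rw [← recoin_simKidReveal I v c y κ hv]
    unfold simReveal simKidReveal
    congr 1
    · simp
    · simp [simSum, SumcheckInstance.localInput, hv]
    · funext l
      simp [simTest, SumcheckInstance.localInput, hv]

/-- The local equations determine masks and blinding values from the shares, sums and tests, so
agreement of the latter is enough. -/
theorem recoin_simCommit (hn : 2 ≤ n) (hI : I.Claim) (i : Fin (N + 1)) :
    simCommit (I.localInput v) (fun u => decide (I.parent u = some v))
      (if v = 0 then I.oracle (point (c 0)) else 0)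
      (recoin I v (c, y, κ)) i = honestCommit I κ (c 0) i v := by
  have hR := recoin_simReveal I v c y κ hI i
  have hsum : simSum (I.localInput v) (if v = 0 then I.oracle (point (c 0)) else 0)
      (recoin I v (c, y, κ)) i = honestSum I κ (c 0) i v := congrArg Reveal.sum hR
  have htest : ∀ l, simTest (I.localInput v) (recoin I v (c, y, κ)) i l
      = (honestReveal I κ (c 0) i v).test l := fun l => congrFun (congrArg Reveal.test hR) l
  have hmask : simMask (I.localInput v) (fun u => decide (I.parent u = some v))
      (if v = 0 then I.oracle (point (c 0)) else 0) (recoin I v (c, y, κ)) i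
      = (honestCommit I κ (c 0) i v).mask := by
    have hkids : (∑ u, if decide (I.parent u = some v) = true then
          (recoin I v (c, y, κ)).2.2.sum (Fin.ofNat (N + 1) i) u else 0)
        = ∑ u, if I.parent u = some v then honestSum I κ (c 0) i u else 0 := by
      refine Finset.sum_congr rfl fun u _ => ?_
      simp only [decide_eq_true_eq]
      split_ifs with hu
      · simp [honestSum, ne_zero_of_parent I hu, recoin]
      · rfl
    have hform : checkForm N i (fun j => sharePoly d v
          ((recoin I v (c, y, κ)).2.2.share (Fin.ofNat (N + 1) j) v)
          ((recoin I v (c, y, κ)).2.2.share (Fin.ofNat (N + 1) j) (v - 1)))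
          (value ((recoin I v (c, y, κ)).1 0)) = honestForm I κ (c 0) i v := by
      refine checkForm_congr ?_ ?_ fun _ => rfl
      · rw [recoin_share_self I v c y κ hn, recoin_share_pred, Fin.ofNat_val_eq_self]
      · have hi : (i : ℕ) - 1 < N + 1 := by omega
        rw [recoin_share_self I v c y κ hn, recoin_share_pred, ofNat_eq hi]
    unfold simMask
    rw [hsum, hkids]
    refine (congrArg (fun a => honestSum I κ (c 0) i v - a
      - ∑ u, if I.parent u = some v then honestSum I κ (c 0) i u else 0) hform).trans ?_
    rw [honest_sum_eq I κ (c 0) i v]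
    ring
  unfold simCommit
  refine Commit.ext ?_ ?_ hmask ?_
  · refine (recoin_share_self I v c y κ hn _).trans ?_
    rw [Fin.ofNat_val_eq_self]; rfl
  · refine (recoin_share_pred I v c y κ _).trans ?_
    rw [Fin.ofNat_val_eq_self]; rfl
  · funext l
    simp only
    have hkids : (∑ u, if decide (I.parent u = some v) = true then
          (recoin I v (c, y, κ)).2.2.blind (Fin.ofNat (N + 1) i) l u else 0)
        = ∑ u, if I.parent u = some v then (honestReveal I κ (c 0) i u).test l else 0 := by
      refine Finset.sum_congr rfl fun u _ => ?_
      simp only [decide_eq_true_eq]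
      split_ifs with hu
      · rw [← recoin_simKidReveal I v c y κ (ne_zero_of_parent I hu), Fin.ofNat_val_eq_self]
        rfl
      · rfl
    rw [hmask, htest, hkids, honest_test_eq I κ (c 0) i v l]
    change _ + (c 0 (Fin.ofNat (N + 1) i)).2 l * _ + _ - (c 0 (Fin.ofNat (N + 1) i)).2 l * _ - _ = _
    ring

theorem view_eq (hn : 2 ≤ n) (hI : I.Claim) :
    (protocol n N d t q).view (honestProver t I) I v (c, y, κ)
      = idealView I v (recoin I v (c, y, κ)) := by
  classical
  have hmsgs : (protocol n N d t q).nodeTranscript (honestProver t I) I (c, y, κ) v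
      = transcriptOf (c v) (phaseMsg N (simCommit (I.localInput v)
          (fun u => decide (I.parent u = some v))
          (if v = 0 then I.oracle (point (c 0)) else 0) (recoin I v (c, y, κ)))
        (simReveal (I.localInput v) (if v = 0 then I.oracle (point (c 0)) else 0)
          (recoin I v (c, y, κ)))) := by
    rw [honest_nodeTranscript]
    refine transcriptOf_congr _ fun i hi => phaseMsg_congr (fun h => ?_) fun h => ?_
    · exact (recoin_simCommit I v c y κ hn hI ⟨i, by omega⟩).symm
    · exact (recoin_simReveal I v c y κ hI ⟨i - 1, by omega⟩).symm
  have hrec := verification_finalHist (honestProver t I) I (c, y, κ) v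
  have hkid : ∀ u, (if I.parent u = some v then some (fun i : Fin (N + 1) =>
        revealOf n d t q ((protocol n N d t q).nodeTranscript (honestProver t I) I (c, y, κ) u) i)
        else none : NodeMsg N t q)
      = if decide (I.parent u = some v) = true then some (simKidReveal (recoin I v (c, y, κ)) u)
        else none := by
    intro u
    simp only [decide_eq_true_eq]
    split_ifs with hu
    · congr 1
      funext i
      rw [recoin_simKidReveal I v c y κ (ne_zero_of_parent I hu)]
      have h := revealOf_transcriptOf (c u) (phaseMsg N (fun i => honestCommit I κ (c 0) i u)
        (fun i => honestReveal I κ (c 0) i u)) (Nat.lt_succ_iff.1 i.2)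
      rw [← honest_nodeTranscript I c y κ u] at h
      simpa [phaseMsg] using h
    · rfl
  have hrec' : (protocol n N d t q).verifier.finalHist I.graph I.oracle
      ((protocol n N d t q).verifierInput (honestProver t I) I (c, y, κ)) y v =
      (idealView I v (recoin I v (c, y, κ))).received := by
    refine hrec.trans ?_
    unfold idealView simulatedView
    congr 1
    · by_cases hv : v = 0
      · subst hv; simp [SumcheckInstance.localInput, recoin]
      · simp [SumcheckInstance.localInput, hv]
    · congr 1
      funext u
      rw [hkid u]
      simp only [SumcheckInstance.localInput, SimpleGraph.mem_neighborSet, I.graph.adj_comm u v]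
      split_ifs <;> rfl
  unfold DIP.view
  rw [hmsgs]
  refine (congrArg (NodeView.mk _ _ _) hrec').trans rfl

end Match

/-- Only the marginal at `v` counts, so the simulating nodes may sample all coins independently of
each other. -/
theorem tvDist_simView_view (I : SumcheckInstance n N d q) (hn : 2 ≤ n) (hI : I.Claim)
    (v : Fin n) : tvDist (DIP.simView (simulator n N d t q) I v)
      ((protocol n N d t q).view (honestProver t I) I v) = 0 := by
  refine tvDist_eq_zero fun A => ?_
  have h1 : prob {c : Fin n → (simulator n N d t q).Coin |
      DIP.simView (simulator n N d t q) I v c ∈ A} = prob {ω | idealView (t := t) I v ω ∈ A} := by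
    refine Eq.trans ?_ (prob_eval v {ω | idealView (t := t) I v ω ∈ A})
    congr 1
    ext c
    exact iff_of_eq (congrArg (· ∈ A) (simView_eq I v c))
  have h2 : prob {ω : (protocol n N d t q).Coins (honestProver t I) |
      (protocol n N d t q).view (honestProver t I) I v ω ∈ A}
      = prob {ω | idealView (t := t) I v ω ∈ A} := by
    refine Eq.trans ?_ (prob_comp_bijective (recoin_bijective I v)
      {ω | idealView (t := t) I v ω ∈ A})
    congr 1
    ext ω
    obtain ⟨c, y, κ⟩ := ω
    exact iff_of_eq (congrArg (· ∈ A) (view_eq I v c y κ hn hI))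
  exact h1.trans h2.symm

end Simulation

/-! ### Message sizes -/

section Sizes

theorem width_le {q : ℕ} (hq : q.Prime) : width q ≤ 2 * Nat.log 2 q := by
  have : 1 ≤ Nat.log 2 q := Nat.log_pos (by norm_num) hq.two_le
  unfold width
  omega

theorem proverBits_le {n d t q C : ℕ} [NeZero n] (hq : q.Prime) (hd : d ≤ C * n) :
    proverBits n d t q ≤ 2 * (2 * (C + 1) + 3 * t + 3) * Nat.log 2 q := by
  have h : d / n ≤ C := Nat.div_le_of_le_mul (by rwa [mul_comm])
  calc proverBits n d t q ≤ (2 * (C + 1) + 3 * t + 3) * (2 * Nat.log 2 q) :=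
        Nat.mul_le_mul (by unfold slots; omega) (width_le hq)
    _ = _ := by ring

/-- The factor `8 * t + 8` comes from `N + 1 ≤ 2 * N` and `width_le`; the extra bit is absorbed by
`N * Nat.log 2 q ≥ 1`. -/
theorem nodeBits_le {N t q : ℕ} (hq : q.Prime) (hN : 0 < N) :
    nodeBits N t q ≤ (8 * t + 9) * (N * Nat.log 2 q) := by
  have h1 : 1 ≤ Nat.log 2 q := Nat.log_pos (by norm_num) hq.two_le
  have h2 : 1 ≤ N * Nat.log 2 q := Nat.mul_pos hN h1
  have h3 : (2 * t + 2) * (N + 1) * width q ≤ (2 * t + 2) * (2 * N) * (2 * Nat.log 2 q) :=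
    Nat.mul_le_mul (Nat.mul_le_mul_left _ (by omega)) (width_le hq)
  calc nodeBits N t q ≤ (2 * t + 2) * (2 * N) * (2 * Nat.log 2 q) + N * Nat.log 2 q :=
        Nat.add_le_add h3 h2
    _ = _ := by ring

end Sizes

end

end DistSumcheck

theorem theorem1 :
    ∃ (proto : ∀ (n N d t q : ℕ) [NeZero n] [Fact q.Prime], DIP n N q)
      (sim : ∀ (n N d t q : ℕ) [NeZero n] [Fact q.Prime], Simulator (proto n N d t q))
      (honest : ∀ (n N d t q : ℕ) [NeZero n] [Fact q.Prime],
        SumcheckInstance n N d q → Prover n (proto n N d t q).bits)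
      (ε : ℕ → ℝ) (c : ℕ),
      -- `ε` is negligible in the number of nodes
      Asymptotics.SuperpolynomialDecay Filter.atTop (fun n : ℕ => (n : ℝ)) ε ∧
      (∀ (n N d t q : ℕ) [NeZero n] [Fact q.Prime], 0 < N → 0 < t →
        -- numbers of rounds
        (proto n N d t q).rounds ≤ c * N ∧
        (proto n N d t q).verifier.rounds ≤ c ∧
        (sim n N d t q).rounds ≤ c ∧
        ∀ I : SumcheckInstance n N d q,
          -- perfect completeness and statistical zero-knowledge
          (I.Claim →
            (proto n N d t q).acceptProb (honest n N d t q I) I = 1 ∧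
            ∀ v : Fin n,
              tvDist (DIP.simView (sim n N d t q) I v)
                ((proto n N d t q).view (honest n N d t q I) I v) ≤ ε n) ∧
          -- soundness
          (¬ I.Claim → ∀ P : Prover n (proto n N d t q).bits,
            (proto n N d t q).acceptProb P I ≤ (N : ℝ) * d / q + 1 / t) ∧
          -- a single oracle query
          (∀ (P : Prover n (proto n N d t q).bits) (ω : (proto n N d t q).Coins P),
            (proto n N d t q).queryCount P I ω ≤ 1) ∧
          (∀ ω : Fin n → (sim n N d t q).Coin, DIP.simQueryCount (sim n N d t q) I ω ≤ 1)) ∧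
      -- message sizes, for fixed `t` and individual degree `d = O(n)`
      (∀ t C : ℕ, 0 < t → ∃ K : ℕ, ∀ (n N d q : ℕ) [NeZero n] [Fact q.Prime],
        0 < N → d ≤ C * n →
          (proto n N d t q).bits ≤ K * Nat.log 2 q ∧
          (proto n N d t q).verifier.bits ≤ K * (N * Nat.log 2 q) ∧
          (sim n N d t q).bits ≤ K * (N * Nat.log 2 q)) := by
  -- The constant `5` serves `2 * N + 3 ≤ 5 * N`. For `n ≤ 1` the trivial bound `1` on the distance
  -- is used.
  refine ⟨fun n N d t q _ _ => protocol n N d t q, fun n N d t q _ _ => simulator n N d t q,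
    fun _ _ _ t _ _ _ I => honestProver t I, fun n => if n ≤ 1 then 1 else 0, 5, ?_, ?_, ?_⟩
  · intro k
    refine tendsto_const_nhds.congr' ?_
    filter_upwards [Filter.eventually_gt_atTop 1] with n hn
    simp [not_le.2 hn]
  · intro n N d t q _ _ hN ht
    refine ⟨?_, ?_, ?_, fun I => ⟨fun hI => ⟨honest_acceptProb I hI, fun v => ?_⟩,
      fun hI P => protocol_soundness ht I hI P, fun P ω => (protocol_queryCount P I ω).le,
      fun c => (simulator_queryCount I c).le⟩⟩
    · change 2 * N + 3 ≤ 5 * N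
      omega
    · change 1 ≤ 5
      norm_num
    · change 1 ≤ 5
      norm_num
    · by_cases hn : n ≤ 1
      · simp only [hn, if_true]
        exact tvDist_le_one _ _
      · simp only [hn, if_false]
        exact (tvDist_simView_view I (by omega) hI v).le
  · intro t C _
    refine ⟨2 * (2 * (C + 1) + 3 * t + 3) + (8 * t + 9), ?_⟩
    intro n N d q _ hq hN hd
    have h2 : 1 ≤ N * Nat.log 2 q :=
      Nat.mul_pos hN (Nat.log_pos (by norm_num) hq.out.two_le)
    refine ⟨?_, ?_, ?_⟩
    · refine (proverBits_le hq.out hd).trans (Nat.mul_le_mul_right _ ?_)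
      exact Nat.le_add_right _ _
    · refine (nodeBits_le hq.out hN).trans (Nat.mul_le_mul_right _ ?_)
      exact Nat.le_add_left _ _
    · refine h2.trans (Nat.le_mul_of_pos_left _ ?_)
      omega
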